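/- Let $W$ be a finite irreducible real reflection group acting on $\mathbf R^n$, $n\ge 1$ (so $W\subset O(n)$ is finite, generated by reflections, and $\mathbf R^n$ has no $W$-invariant subspaces other than $0$ and $\mathbf R^n$). Roots are the unit normals to the reflecting hyperplanes of $W$; for a unit vector $v$, $R(v)$ is the reflection in $v^\perp$. Let $\alpha_1,\dots,\alpha_n$ be a simple system of $W$ (the inward unit normals of a fundamental chamber), ordered so that, for some $s$, $\{\alpha_1,\dots,\alpha_s\}$ and $\{\alpha_{s+1},\dots,\alpha_n\}$ are orthonormal sets. Let $R_i=R(\alpha_i)$, let $\gamma=R_1R_2\cdots R_n$ be the corresponding Coxeter element and $h$ its order, and put $\rho_i=R_1R_2\cdots R_{i-1}\alpha_i$ with the indices of $\alpha$ and $R$ read modulo $n$. Then (Steinberg) the positive roots are $\rho_1,\dots,\rho_{nh/2}$, and they are ordered by this numbering. Let $l(w)$ be the least number of reflections of $W$ with product $w$, and write $u\le w$ if $l(w)=l(u)+l(u^{-1}w)$. Let $X(\gamma)$ be the set of simplices with vertices $\rho_1,\dots,\rho_{nh/2}$, with an edge joining $\rho_i$ and $\rho_j$, $i<j$, whenever $R(\rho_i)R(\rho_j)\le\gamma^{-1}$,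 and in which a nonempty set of distinct vertices spans a simplex when its elements are pairwise joined by edges. For $\sigma\le\gamma$ let $X(\sigma)$ be the collection of simplices of $X(\gamma)$ all of whose vertices are positive roots $\tau$ with $R(\tau)\le\sigma$. **Theorem.** Let $\sigma\le\gamma$ with $l(\sigma)=2$, and let $\tau_1,\dots,\tau_t$ be the positive roots $\tau$ with $R(\tau)\le\sigma$, listed in the above order. Then $X(\sigma)$ is a path: its simplices are exactly the $t$ distinct vertices $\tau_1,\dots,\tau_t$ and the $t-1$ edges $\langle\tau_i,\tau_{i+1}\rangle$, $1\le i\le t-1$. Moreover $t\ge 2$, $$\sigma=R(\tau_1)R(\tau_t),\qquad\text{and}\qquad \sigma=R(\tau_{i+1})R(\tau_i)\quad\text{for all } 1\le i\le t-1 .$$ -/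

import Mathlib

noncomputable section

namespace CoxeterComplex

/-- Euclidean space `ℝⁿ`. -/
abbrev Euc (n : ℕ) : Type := EuclideanSpace ℝ (Fin n)

/-- The orthogonal group `O(n)`; multiplication is composition, `(A * B) x = A (B x)`. -/
abbrev Orth (n : ℕ) : Type := Euc n ≃ₗᵢ[ℝ] Euc n

variable {n : ℕ}

/-- The orthogonal reflection `R(v)` in the hyperplane `v^⊥` (used for unit vectors `v`). -/
def refl (v : Euc n) : Orth n := ((Submodule.span ℝ {v})ᗮ).reflection

/-- A root of `W`: a unit normal to the hyperplane of a reflection belonging to `W`. -/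
def IsRoot (W : Subgroup (Orth n)) (v : Euc n) : Prop := ‖v‖ = 1 ∧ refl v ∈ W

/-- The set of all reflections in `W`. -/
def reflections (W : Subgroup (Orth n)) : Set (Orth n) := {r | ∃ v, IsRoot W v ∧ r = refl v}

/-- `W` is a finite irreducible real reflection group acting on `ℝⁿ`: it is finite, it is generated
by its reflections, and `ℝⁿ ≠ 0` has no invariant subspaces besides `0` and `ℝⁿ`. -/
structure IsFiniteIrreducibleReflectionGroup (W : Subgroup (Orth n)) : Prop where
  finite : Finite W
  generated : Subgroup.closure (reflections W) = W
  pos : 0 < n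
  irreducible : ∀ U : Submodule ℝ (Euc n), (∀ w ∈ W, ∀ x ∈ U, w x ∈ U) → U = ⊥ ∨ U = ⊤

/-- `v` is a linear combination of the vectors `a i` with nonnegative coefficients. -/
def IsNonnegComb (a : Fin n → Euc n) (v : Euc n) : Prop :=
  ∃ c : Fin n → ℝ, (∀ i, 0 ≤ c i) ∧ v = ∑ i, c i • a i

/-- The roots `a 0, …, a (n - 1)` form a simple system of `W`, i.e. they are the inward unit normals
of a fundamental chamber `{x | ∀ i, 0 < ⟪a i, x⟫}`. -/
structure IsSimpleSystem (W : Subgroup (Orth n)) (a : Fin n → Euc n) : Prop where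
  isRoot : ∀ i, IsRoot W (a i)
  linearIndependent : LinearIndependent ℝ a
  sign : ∀ v, IsRoot W v → IsNonnegComb a v ∨ IsNonnegComb a (-v)

/-- The first `s` of the vectors `a i` are mutually orthogonal, and so are the remaining ones. -/
def IsBipartite (a : Fin n → Euc n) (s : ℕ) : Prop :=
  s ≤ n ∧ ∀ i j : Fin n, i ≠ j → ((i : ℕ) < s ↔ (j : ℕ) < s) → inner ℝ (a i) (a j) = 0

/-- A positive root with respect to the simple system `a`. -/
def IsPositiveRoot (W : Subgroup (Orth n)) (a : Fin n → Euc n) (v : Euc n) : Prop :=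
  IsRoot W v ∧ IsNonnegComb a v

/-- Reflection length: the least number of reflections of `W` whose product is `w`. -/
def len (W : Subgroup (Orth n)) (w : Orth n) : ℕ :=
  sInf {k | ∃ L : List (Orth n), (∀ r ∈ L, r ∈ reflections W) ∧ L.prod = w ∧ L.length = k}

/-- The partial order on `W` given by reflection length. -/
def Precedes (W : Subgroup (Orth n)) (u w : Orth n) : Prop :=
  u ∈ W ∧ w ∈ W ∧ len W w = len W u + len W (u⁻¹ * w)

section Numbering

variable [NeZero n]

/-- The product `R(a 0) R(a 1) ⋯ R(a (k - 1))`, with indices read modulo `n`. -/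
def prefixProd (a : Fin n → Euc n) : ℕ → Orth n
  | 0 => 1
  | k + 1 => prefixProd a k * refl (a (Fin.ofNat n k))

/-- The Coxeter element `R(a 0) R(a 1) ⋯ R(a (n - 1))`. -/
def cox (a : Fin n → Euc n) : Orth n := prefixProd a n

/-- The root `R(a 0) ⋯ R(a (k - 1)) (a k)`, with indices read modulo `n`. Numbering starts at `0`,
so `rho a k` is the root usually written `ρ_{k+1}`. -/
def rho (a : Fin n → Euc n) (k : ℕ) : Euc n := prefixProd a k (a (Fin.ofNat n k))

/-- The number `n h / 2`, where `h` is the order of the Coxeter element. -/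
def numPos (a : Fin n → Euc n) : ℕ := n * orderOf (cox a) / 2

/-- Two of the vertices `rho a 0, …, rho a (n h / 2 - 1)` are joined by an edge when, for `i < j`
their indices, `R(ρ_i) R(ρ_j)` precedes the inverse of the Coxeter element. -/
def Joined (W : Subgroup (Orth n)) (a : Fin n → Euc n) (u v : Euc n) : Prop :=
  ∃ i j : ℕ, i < j ∧ j < numPos a ∧
    Precedes W (refl (rho a i) * refl (rho a j)) (cox a)⁻¹ ∧
    ((u = rho a i ∧ v = rho a j) ∨ (u = rho a j ∧ v = rho a i))

/-- The simplices of `X(γ)`, where `γ = cox a`. A simplex is given by its finite set of vertices: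
the vertices are the `rho a i` with `i < n h / 2`, and a nonempty finite set of vertices spans
a simplex when its elements are pairwise joined by edges. -/
def X (W : Subgroup (Orth n)) (a : Fin n → Euc n) : Set (Finset (Euc n)) :=
  {S | S.Nonempty ∧ (∀ v ∈ S, ∃ i < numPos a, v = rho a i) ∧
    ∀ u ∈ S, ∀ v ∈ S, u ≠ v → Joined W a u v}

/-- The set of positive roots whose reflections precede `g`. -/
def rootsBelow (W : Subgroup (Orth n)) (a : Fin n → Euc n) (g : Orth n) : Set (Euc n) :=
  {v | IsPositiveRoot W a v ∧ Precedes W (refl v) g}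

/-- The simplices of `X(γ)` all of whose vertices are positive roots with reflection below `g`. -/
def XSub (W : Subgroup (Orth n)) (a : Fin n → Euc n) (g : Orth n) : Set (Finset (Euc n)) :=
  {S | S ∈ X W a ∧ ∀ v ∈ S, v ∈ rootsBelow W a g}

/-- `τ 0, …, τ (t - 1)` lists the positive roots whose reflections precede `g`, in the order in which
they occur in the sequence `rho a 0, …, rho a (n h / 2 - 1)`. -/
def IsOrderedList (W : Subgroup (Orth n)) (a : Fin n → Euc n) (g : Orth n) (t : ℕ)
    (τ : Fin t → Euc n) : Prop :=
  Set.range τ = rootsBelow W a g ∧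
    ∃ k : Fin t → ℕ, StrictMono k ∧ ∀ i, k i < numPos a ∧ τ i = rho a (k i)

end Numbering

end CoxeterComplex

end

namespace CoxeterComplex

/-! ### Reflections, roots and simple systems -/

section

variable {n : ℕ}

/-! Write γ = `cox a` and μ = 2(1 - γ)⁻¹, which exists because γ fixes no nonzero vector. The proof
reads the order of the roots off the non-symmetric form ⟨μx, y⟩, which satisfies ⟨μx, x⟩ = ⟨x, x⟩.

Two facts about this form carry the argument. Sign pattern: μρ_k is the k-th fundamental weight
moved by P_k = `prefixProd a k`, so ⟨μρ_k, v⟩ is a simple coordinate of P_k⁻¹v; it is nonnegative at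
ρ_j for j ≥ k and nonpositive for j < k (`IsSteinbergForm`). Vanishing: if R(u)R(v) is a product of
two distinct reflections preceding γ, then ⟨μu, v⟩ = 0 (`inner_eq_zero_of_precedes`), by a dimension
count.

All roots below σ lie in one plane, and each is the first factor of a factorization σ = R(u)R(v)
with v again below σ. Expanding a third root of the plane in u and v, the sign pattern forbids it to
lie cyclically between v and u (`IsSteinbergForm.not_between`). Hence v is the cyclic predecessor of
u, which gives all the stated factorizations. An edge from τ_i to a later τ_j puts τ_i on the line
of the plane where ⟨μτ_j, ·⟩ vanishes; τ_{j-1} spans that line, so i = j - 1.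

The sign pattern needs Steinberg's enumeration of the positive roots, which is proved here too. A
Perron–Frobenius vector of the Gram matrix yields two functionals p, q, nonnegative on positive
roots, on which the two blocks of simple reflections act as a planar dihedral group of angle θ.
Positivity of roots forces θ = π/m, then h = m, and the product of the first nh/2 reflections makes
every positive root negative. -/

theorem refl_apply {v : Euc n} (hv : ‖v‖ = 1) (x : Euc n) :
    refl v x = x - (2 * inner ℝ v x) • v := by
  have : refl v x = -(Submodule.span ℝ {v}).reflection x :=
    Submodule.reflection_orthogonal_apply _ _
  rw [this, Submodule.reflection_singleton_apply, hv]
  simp only [RCLike.ofReal_real_eq_id, id, one_pow, div_one, neg_sub, two_smul, two_mul, add_smul]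

theorem refl_self {v : Euc n} (hv : ‖v‖ = 1) : refl v v = -v := by
  rw [refl_apply hv, real_inner_self_eq_norm_sq, hv]
  module

theorem refl_of_inner_eq_zero {v x : Euc n} (hv : ‖v‖ = 1) (h : inner ℝ v x = 0) :
    refl v x = x := by
  rw [refl_apply hv, h]
  simp

theorem refl_neg (v : Euc n) : refl (-v) = refl v := by
  have : Submodule.span ℝ {-v} = Submodule.span ℝ {v} := by
    rw [← Set.neg_singleton, Submodule.span_neg]
  unfold refl
  congr 2

theorem refl_mul_self (v : Euc n) : refl v * refl v = 1 :=
  Submodule.reflection_mul_reflection _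

theorem refl_inv (v : Euc n) : (refl v)⁻¹ = refl v :=
  inv_eq_of_mul_eq_one_left (refl_mul_self v)

theorem refl_refl (v x : Euc n) : refl v (refl v x) = x :=
  Submodule.reflection_reflection _ _

theorem inner_inv_apply (g : Orth n) (x y : Euc n) :
    inner ℝ (g⁻¹ x) y = inner ℝ x (g y) := by
  rw [← g.inner_map_map (g⁻¹ x) y]
  congr 1
  exact g.apply_symm_apply x

theorem apply_inv_self (g : Orth n) (x : Euc n) : g (g⁻¹ x) = x := g.apply_symm_apply x

theorem inv_apply_self (g : Orth n) (x : Euc n) : g⁻¹ (g x) = x := g.symm_apply_apply x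

theorem refl_map (g : Orth n) {v : Euc n} (hv : ‖v‖ = 1) :
    refl (g v) = g * refl v * g⁻¹ := by
  ext1 x
  have hgv : ‖g v‖ = 1 := by rw [g.norm_map, hv]
  rw [refl_apply hgv]
  change _ = g (refl v (g⁻¹ x))
  rw [refl_apply hv, map_sub, map_smul, apply_inv_self]
  congr 3
  rw [real_inner_comm, real_inner_comm _ v, inner_inv_apply]

theorem eq_or_eq_neg_of_smul {u v : Euc n} (hu : ‖u‖ = 1) (hv : ‖v‖ = 1) {c : ℝ}
    (h : u = c • v) : u = v ∨ u = -v := by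
  have : |c| = 1 := by
    have := congrArg norm h
    rw [norm_smul, hu, hv] at this
    simpa using this.symm
  rcases eq_or_eq_neg_of_abs_eq this with h1 | h1 <;> subst h1 <;> simp [h]

theorem eq_or_eq_neg_of_refl_eq {u v : Euc n} (hu : ‖u‖ = 1) (hv : ‖v‖ = 1)
    (h : refl u = refl v) : u = v ∨ u = -v := by
  have h1 : refl v u = -u := by rw [← h, refl_self hu]
  rw [refl_apply hv] at h1
  apply eq_or_eq_neg_of_smul hu hv (c := inner ℝ v u)
  linear_combination (norm := module) (1 / 2 : ℝ) • h1

section Roots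

variable {W : Subgroup (Orth n)}

theorem IsRoot.neg {v : Euc n} (h : IsRoot W v) : IsRoot W (-v) :=
  ⟨by rw [norm_neg, h.1], by rw [refl_neg]; exact h.2⟩

theorem IsRoot.map {v : Euc n} (h : IsRoot W v) {g : Orth n} (hg : g ∈ W) : IsRoot W (g v) :=
  ⟨by rw [g.norm_map, h.1], by
    rw [refl_map g h.1]; exact W.mul_mem (W.mul_mem hg h.2) (W.inv_mem hg)⟩

theorem IsRoot.ne_zero {v : Euc n} (h : IsRoot W v) : v ≠ 0 := by
  rintro rfl
  simpa using h.1

theorem IsSimpleSystem.pos_or_neg {a : Fin n → Euc n}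
    (ha : IsSimpleSystem W a) {v : Euc n} (hv : IsRoot W v) :
    IsPositiveRoot W a v ∨ IsPositiveRoot W a (-v) :=
  (ha.sign v hv).imp (fun h => ⟨hv, h⟩) (fun h => ⟨hv.neg, h⟩)

end Roots

section Coordinates

variable [NeZero n] {W : Subgroup (Orth n)} {a : Fin n → Euc n}

/-- The basis of `ℝⁿ` given by a simple system. -/
noncomputable def IsSimpleSystem.basis (ha : IsSimpleSystem W a) : Module.Basis (Fin n) ℝ (Euc n) :=
  basisOfLinearIndependentOfCardEqFinrank ha.linearIndependent (by simp)

/-- The coordinates of a vector with respect to a simple system. -/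
noncomputable def IsSimpleSystem.coord (ha : IsSimpleSystem W a) (i : Fin n) : Euc n →ₗ[ℝ] ℝ :=
  ha.basis.coord i

theorem IsSimpleSystem.basis_apply (ha : IsSimpleSystem W a) (i : Fin n) : ha.basis i = a i := by
  simp [IsSimpleSystem.basis]

theorem IsSimpleSystem.sum_coord (ha : IsSimpleSystem W a) (v : Euc n) :
    ∑ i, ha.coord i v • a i = v := by
  have := ha.basis.sum_repr v
  simp only [ha.basis_apply] at this
  exact this

theorem IsSimpleSystem.coord_sum (ha : IsSimpleSystem W a) (c : Fin n → ℝ) (j : Fin n) :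
    ha.coord j (∑ i, c i • a i) = c j := by
  have := ha.basis.repr_sum_self c
  simp only [ha.basis_apply] at this
  exact congrFun this j

theorem IsSimpleSystem.coord_self (ha : IsSimpleSystem W a) (i : Fin n) :
    ha.coord i (a i) = 1 := by
  simp [IsSimpleSystem.coord, ← ha.basis_apply]

theorem IsSimpleSystem.coord_of_ne (ha : IsSimpleSystem W a) {i j : Fin n} (h : i ≠ j) :
    ha.coord i (a j) = 0 := by
  simp [IsSimpleSystem.coord, ← ha.basis_apply, h.symm]

theorem IsSimpleSystem.ext_coord (ha : IsSimpleSystem W a) {u v : Euc n}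
    (h : ∀ i, ha.coord i u = ha.coord i v) : u = v := by
  rw [← ha.sum_coord u, ← ha.sum_coord v]
  simp only [h]

theorem IsSimpleSystem.isNonnegComb_iff (ha : IsSimpleSystem W a) (v : Euc n) :
    IsNonnegComb a v ↔ ∀ i, 0 ≤ ha.coord i v := by
  constructor
  · rintro ⟨c, hc, rfl⟩ i
    rw [ha.coord_sum]
    exact hc i
  · intro h
    exact ⟨fun i => ha.coord i v, h, (ha.sum_coord v).symm⟩

theorem IsSimpleSystem.isPositiveRoot_simple (ha : IsSimpleSystem W a) (i : Fin n) :
    IsPositiveRoot W a (a i) := by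
  refine ⟨ha.isRoot i, (ha.isNonnegComb_iff _).2 fun j => ?_⟩
  rcases eq_or_ne j i with rfl | h
  · rw [ha.coord_self]; norm_num
  · rw [ha.coord_of_ne h]

theorem IsSimpleSystem.not_pos_and_neg (ha : IsSimpleSystem W a) {v : Euc n}
    (h : IsPositiveRoot W a v) : ¬ IsPositiveRoot W a (-v) := by
  intro h'
  apply h.1.ne_zero
  refine ha.ext_coord fun i => ?_
  have h1 := (ha.isNonnegComb_iff _).1 h.2 i
  have h2 := (ha.isNonnegComb_iff _).1 h'.2 i
  rw [map_neg] at h2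
  rw [map_zero]
  linarith

/-- A root with a positive coordinate is positive. -/
theorem IsSimpleSystem.isPositiveRoot_of_coord_pos (ha : IsSimpleSystem W a) {v : Euc n}
    (hv : IsRoot W v) {i : Fin n} (h : 0 < ha.coord i v) : IsPositiveRoot W a v := by
  refine (ha.pos_or_neg hv).resolve_right fun h' => ?_
  have := (ha.isNonnegComb_iff _).1 h'.2 i
  rw [map_neg] at this
  linarith

theorem IsSimpleSystem.eq_of_smul (ha : IsSimpleSystem W a) {u v : Euc n}
    (hu : IsPositiveRoot W a u) (hv : IsPositiveRoot W a v) {c : ℝ} (h : u = c • v) : u = v := by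
  refine (eq_or_eq_neg_of_smul hu.1.1 hv.1.1 h).resolve_right fun h' => ?_
  rw [h'] at hu
  exact ha.not_pos_and_neg hv hu

theorem IsSimpleSystem.eq_of_refl_eq (ha : IsSimpleSystem W a) {u v : Euc n}
    (hu : IsPositiveRoot W a u) (hv : IsPositiveRoot W a v) (h : refl u = refl v) : u = v := by
  refine (eq_or_eq_neg_of_refl_eq hu.1.1 hv.1.1 h).resolve_right fun h' => ?_
  rw [h'] at hu
  exact ha.not_pos_and_neg hv hu

theorem IsSimpleSystem.coord_refl_of_ne (ha : IsSimpleSystem W a) {i j : Fin n} (h : i ≠ j)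
    (v : Euc n) : ha.coord i (refl (a j) v) = ha.coord i v := by
  rw [refl_apply (ha.isRoot j).1, map_sub, map_smul, ha.coord_of_ne h]
  simp

theorem IsSimpleSystem.coord_refl_self (ha : IsSimpleSystem W a) (i : Fin n)
    (v : Euc n) : ha.coord i (refl (a i) v) = ha.coord i v - 2 * inner ℝ (a i) v := by
  rw [refl_apply (ha.isRoot i).1, map_sub, map_smul, ha.coord_self]
  simp

/-- A simple reflection makes only one positive root negative. -/
theorem IsSimpleSystem.eq_simple (ha : IsSimpleSystem W a) {v : Euc n}
    (hv : IsPositiveRoot W a v) {k : Fin n} (h : ¬ IsPositiveRoot W a (refl (a k) v)) :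
    v = a k := by
  refine ha.eq_of_smul hv (ha.isPositiveRoot_simple k) (c := ha.coord k v) ?_
  refine ha.ext_coord fun i => ?_
  rw [map_smul]
  rcases eq_or_ne i k with rfl | hik
  · rw [ha.coord_self, smul_eq_mul, mul_one]
  · rw [ha.coord_of_ne hik, smul_zero]
    by_contra h0
    refine h (ha.isPositiveRoot_of_coord_pos (hv.1.map (ha.isRoot k).2) (i := i) ?_)
    rw [ha.coord_refl_of_ne hik]
    exact lt_of_le_of_ne ((ha.isNonnegComb_iff _).1 hv.2 i) (Ne.symm h0)

/-- Distinct simple roots form obtuse or right angles. -/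
theorem IsSimpleSystem.inner_nonpos (ha : IsSimpleSystem W a) {i j : Fin n} (h : i ≠ j) :
    inner ℝ (a i) (a j) ≤ 0 := by
  have h1 : IsPositiveRoot W a (refl (a i) (a j)) := by
    by_contra h'
    have := ha.eq_simple (ha.isPositiveRoot_simple j) h'
    exact h (ha.linearIndependent.injective this).symm
  have h2 := (ha.isNonnegComb_iff _).1 h1.2 i
  rw [ha.coord_refl_self, ha.coord_of_ne h] at h2
  linarith

/-- A product of simple reflections which makes no simple root negative is trivial. -/
theorem IsSimpleSystem.prod_eq_one (ha : IsSimpleSystem W a) (L : List (Fin n))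
    (h : ∀ i, IsPositiveRoot W a ((L.map fun i => refl (a i)).prod (a i))) :
    (L.map fun i => refl (a i)).prod = 1 := by
  induction hl : L.length using Nat.strong_induction_on generalizing L with
  | _ l ih =>
  rcases List.eq_nil_or_concat' L with rfl | ⟨L', k, rfl⟩
  · simp
  have hmem : ∀ L : List (Fin n), (L.map fun i => refl (a i)).prod ∈ W := fun L =>
    W.list_prod_mem fun x hx => by
      obtain ⟨i, -, rfl⟩ := List.mem_map.1 hx
      exact (ha.isRoot i).2
  -- Exchange condition: reading the word from the right, `a k` first turns negative at some letter
  -- `j`, where its image must equal `a j`. Conjugation then cancels that letter against the final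
  -- `k`.
  have key : ∀ L' : List (Fin n), ¬ IsPositiveRoot W a ((L'.map fun i => refl (a i)).prod (a k)) →
      ∃ A B : List (Fin n), A.length + B.length < L'.length ∧
      (L'.map fun i => refl (a i)).prod * refl (a k) =
        ((A ++ B).map fun i => refl (a i)).prod := by
    intro L'
    induction L' with
    | nil => intro h'; exact absurd (ha.isPositiveRoot_simple k) (by simpa using h')
    | cons j B ihB =>
      intro h'
      by_cases hB : IsPositiveRoot W a ((B.map fun i => refl (a i)).prod (a k))
      · have h1 := ha.eq_simple hB (k := j) (by
          simpa using h')
        refine ⟨[], B, by simp, ?_⟩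
        have h2 := refl_map (B.map fun i => refl (a i)).prod (ha.isRoot k).1
        rw [h1] at h2
        simp only [List.map_cons, List.prod_cons, List.nil_append]
        rw [h2, mul_assoc, mul_assoc, mul_assoc, inv_mul_cancel_left, refl_mul_self, mul_one]
      · obtain ⟨A, C, h1, h2⟩ := ihB hB
        refine ⟨j :: A, C, by simp; omega, ?_⟩
        simp only [List.map_cons, List.prod_cons, List.cons_append, mul_assoc]
        rw [h2]
  have hk := h k
  simp only [List.map_append, List.map_cons, List.map_nil, List.prod_append, List.prod_cons,
    List.prod_nil, mul_one] at hk
  obtain ⟨A, B, h1, h2⟩ := key L' (by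
    intro h'
    refine ha.not_pos_and_neg h' ?_
    have : -((L'.map fun i => refl (a i)).prod (a k)) =
        ((L'.map fun i => refl (a i)).prod * refl (a k)) (a k) := by
      change _ = (L'.map fun i => refl (a i)).prod (refl (a k) (a k))
      rw [refl_self (ha.isRoot k).1, map_neg]
    rw [this]
    exact hk)
  have h3 : ((L' ++ [k]).map fun i => refl (a i)).prod =
      ((A ++ B).map fun i => refl (a i)).prod := by
    rw [← h2]; simp
  rw [h3] at h ⊢
  simp only [List.length_append, List.length_cons, List.length_nil] at hl
  exact ih (A ++ B).length (by simp; omega) (A ++ B) h rfl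

/-- The fundamental weights: the basis dual to the simple roots. -/
noncomputable def IsSimpleSystem.weight (ha : IsSimpleSystem W a) (i : Fin n) : Euc n :=
  (InnerProductSpace.toDual ℝ (Euc n)).symm (LinearMap.toContinuousLinearMap (ha.coord i))

theorem IsSimpleSystem.inner_weight (ha : IsSimpleSystem W a) (i : Fin n) (v : Euc n) :
    inner ℝ (ha.weight i) v = ha.coord i v := by
  simp [IsSimpleSystem.weight]

end Coordinates

end

/-! ### Irreducibility and the Perron–Frobenius vector -/

section

variable {n : ℕ} [NeZero n] {W : Subgroup (Orth n)} {a : Fin n → Euc n}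

/-- Otherwise the part `u` of `v` supported in `A`, which has the same inner products with the `a k`
for `k ∈ A`, satisfies ⟨u, u⟩ ≤ 0 and hence vanishes. -/
theorem IsSimpleSystem.exists_inner_pos (ha : IsSimpleSystem W a) {v : Euc n} {A : Set (Fin n)}
    (hv : ∀ i, 0 ≤ ha.coord i v) (hA : ∀ i ∈ A, ∀ j ∉ A, inner ℝ (a i) (a j) = 0)
    {i : Fin n} (hi : i ∈ A) (h0 : ha.coord i v ≠ 0) :
    ∃ k ∈ A, 0 < inner ℝ (a k) v := by
  classical
  by_contra! hcon
  set u : Euc n := ∑ i, (if i ∈ A then ha.coord i v else 0) • a i with hu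
  have huA : ∀ k ∈ A, inner ℝ (a k) u = inner ℝ (a k) v := by
    intro k hk
    conv_rhs => rw [← ha.sum_coord v]
    rw [hu, inner_sum, inner_sum]
    refine Finset.sum_congr rfl fun j _ => ?_
    split_ifs with hj
    · rfl
    · rw [zero_smul, inner_zero_right, inner_smul_right, hA k hk j hj, mul_zero]
  have huu : inner ℝ u u ≤ 0 := by
    conv_lhs => arg 2; rw [hu]
    rw [sum_inner]
    refine Finset.sum_nonpos fun j _ => ?_
    rw [inner_smul_left]
    split_ifs with hj
    · rw [huA j hj]
      exact mul_nonpos_of_nonneg_of_nonpos (hv j) (hcon j hj)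
    · simp
  have hu0 : u = 0 := by
    by_contra hne
    exact absurd (real_inner_self_pos.2 hne) (not_lt.2 huu)
  have := congrArg (ha.coord i) hu0
  rw [hu, ha.coord_sum, if_pos hi, map_zero] at this
  exact h0 this

/-- If the simple roots split into two mutually orthogonal sets, every positive root is supported
in one of them. -/
theorem IsSimpleSystem.support_of_orthogonal (ha : IsSimpleSystem W a) (hfin : Finite W)
    {A : Set (Fin n)} (hA : ∀ i ∈ A, ∀ j ∉ A, inner ℝ (a i) (a j) = 0) {v : Euc n}
    (hv : IsPositiveRoot W a v) : (∀ i ∈ A, ha.coord i v = 0) ∨ ∀ j ∉ A, ha.coord j v = 0 := by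
  classical
  by_contra! hcon
  obtain ⟨⟨i, hi, hiv⟩, j, hj, hjv⟩ := hcon
  -- Descent on height: a suitable simple reflection from `A` lowers the sum of coordinates, keeps
  -- coordinate `j` (hence positivity), and stays in `S`. This contradicts minimality.
  let S : Set (Euc n) := {u | (∃ w ∈ W, u = w v) ∧ IsPositiveRoot W a u ∧
    ha.coord j u = ha.coord j v ∧ ∃ i ∈ A, ha.coord i u ≠ 0}
  have hS : S.Finite := by
    refine (Set.finite_range fun w : W => (w : Orth n) v).subset ?_
    rintro u ⟨⟨w, hw, rfl⟩, -⟩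
    exact ⟨⟨w, hw⟩, rfl⟩
  obtain ⟨u, hu, hmin⟩ := S.exists_min_image (fun u => ∑ i, ha.coord i u) hS
    ⟨v, ⟨1, W.one_mem, rfl⟩, hv, rfl, i, hi, hiv⟩
  obtain ⟨⟨w, hw, rfl⟩, hpos, hju, i', hi', hne⟩ := hu
  set u := w v with hudef
  obtain ⟨k, hk, hku⟩ := ha.exists_inner_pos ((ha.isNonnegComb_iff _).1 hpos.2) hA hi' hne
  have hjk : j ≠ k := fun h => hj (h ▸ hk)
  have hju' : ha.coord j (refl (a k) u) = ha.coord j v := by rw [ha.coord_refl_of_ne hjk, hju]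
  have hpos' : IsPositiveRoot W a (refl (a k) u) := by
    refine ha.isPositiveRoot_of_coord_pos (hpos.1.map (ha.isRoot k).2) (i := j) ?_
    rw [hju']
    exact lt_of_le_of_ne ((ha.isNonnegComb_iff _).1 hv.2 j) (Ne.symm hjv)
  have hmem : refl (a k) u ∈ S := by
    refine ⟨⟨refl (a k) * w, W.mul_mem (ha.isRoot k).2 hw, rfl⟩, hpos', hju', ?_⟩
    by_cases hik : i' = k
    -- If the reflection killed the whole `A`-part, that part would be a multiple of `a k`; but then
    -- coordinate `k` only changes sign.
    · by_contra! h0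
      have h1 := h0 i' hi'
      have h2 : ∀ l ∈ A, l ≠ k → ha.coord l u = 0 := fun l hl hlk => by
        rw [← ha.coord_refl_of_ne hlk]; exact h0 l hl
      have h3 : inner ℝ (a k) u = ha.coord k u := by
        conv_lhs => rw [← ha.sum_coord u]
        rw [inner_sum, Finset.sum_eq_single k]
        · rw [inner_smul_right, real_inner_self_eq_norm_sq, (ha.isRoot k).1]; norm_num
        · intro l _ hlk
          rw [inner_smul_right]
          by_cases hl : l ∈ A
          · rw [h2 l hl hlk, zero_mul]
          · rw [hA k hk l hl, mul_zero]
        · simp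
      rw [hik, ha.coord_refl_self] at h1
      rw [h3] at h1 hku
      linarith
    · exact ⟨i', hi', by rw [ha.coord_refl_of_ne hik]; exact hne⟩
  have h4 := hmin _ hmem
  have h5 : ∑ i, ha.coord i (refl (a k) u) < ∑ i, ha.coord i u := by
    refine Finset.sum_lt_sum (fun l _ => ?_) ⟨k, Finset.mem_univ _, ?_⟩
    · rcases eq_or_ne l k with rfl | hlk
      · rw [ha.coord_refl_self]; linarith
      · rw [ha.coord_refl_of_ne hlk]
    · rw [ha.coord_refl_self]; linarith
  exact absurd h4 (not_le.2 h5)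

/-- The Coxeter graph of an irreducible group is connected. -/
theorem IsSimpleSystem.exists_inner_ne_zero (ha : IsSimpleSystem W a)
    (hW : IsFiniteIrreducibleReflectionGroup W) {A : Set (Fin n)} (hne : A.Nonempty)
    (huniv : A ≠ Set.univ) : ∃ i ∈ A, ∃ j ∉ A, inner ℝ (a i) (a j) ≠ 0 := by
  by_contra! hA
  -- The span of the simple roots in `A`. A positive root supported off `A` is orthogonal to it and
  -- one supported in `A` lies in it, so every reflection preserves it.
  let U : Submodule ℝ (Euc n) :=
    { carrier := {x | ∀ j ∉ A, ha.coord j x = 0}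
      add_mem' := fun hx hy j hj => by rw [map_add, hx j hj, hy j hj, add_zero]
      zero_mem' := fun j _ => map_zero _
      smul_mem' := fun c x hx j hj => by rw [map_smul, hx j hj, smul_zero] }
  have hrefl : ∀ v, IsPositiveRoot W a v → ∀ x ∈ U, refl v x ∈ U := by
    intro v hv x hx j hj
    rcases ha.support_of_orthogonal hW.finite hA hv with h | h
    · have : inner ℝ v x = 0 := by
        rw [← ha.sum_coord v, ← ha.sum_coord x, sum_inner]
        refine Finset.sum_eq_zero fun k _ => ?_
        rw [inner_sum]
        refine Finset.sum_eq_zero fun l _ => ?_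
        rw [inner_smul_left, inner_smul_right]
        by_cases hk : k ∈ A
        · rw [h k hk]; simp
        · by_cases hl : l ∈ A
          · rw [real_inner_comm, hA l hl k hk]; simp
          · rw [hx l hl]; simp
      rw [refl_of_inner_eq_zero hv.1.1 this]
      exact hx j hj
    · rw [refl_apply hv.1.1, map_sub, map_smul, hx j hj, h j hj]
      simp
  have hinv : ∀ w ∈ W, ∀ x ∈ U, w x ∈ U := by
    intro w hw
    rw [← hW.generated] at hw
    induction hw using Subgroup.closure_induction'' with
    | mem r hr =>
      obtain ⟨v, hv, rfl⟩ := hr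
      rcases ha.pos_or_neg hv with h | h
      · exact hrefl v h
      · rw [← refl_neg]; exact hrefl _ h
    | inv_mem r hr =>
      obtain ⟨v, hv, rfl⟩ := hr
      rw [refl_inv]
      rcases ha.pos_or_neg hv with h | h
      · exact hrefl v h
      · rw [← refl_neg]; exact hrefl _ h
    | one => exact fun x hx => hx
    | mul g h _ _ hg hh => exact fun x hx => hg _ (hh x hx)
  obtain ⟨i, hi⟩ := hne
  obtain ⟨j, hj⟩ := (Set.ne_univ_iff_exists_notMem A).1 huniv
  rcases hW.irreducible U hinv with h | h
  · have : a i ∈ U := fun k hk => ha.coord_of_ne (fun h => hk (h ▸ hi))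
    rw [h] at this
    exact (ha.isRoot i).ne_zero this
  · have : a j ∈ U := h ▸ Submodule.mem_top
    have := this j hj
    rw [ha.coord_self] at this
    exact one_ne_zero this

/-- A Perron–Frobenius eigenvector of the Gram matrix of a simple system. -/
theorem IsSimpleSystem.exists_perron (ha : IsSimpleSystem W a)
    (hW : IsFiniteIrreducibleReflectionGroup W) :
    ∃ (c : Fin n → ℝ) (lam : ℝ), (∀ i, 0 < c i) ∧ 0 < lam ∧
      ∀ i, inner ℝ (a i) (∑ j, c j • a j) = lam * c i := by
  let Ll : Euc n →ₗ[ℝ] Euc n := ∑ i, (EuclideanSpace.proj i : Euc n →L[ℝ] ℝ).toLinearMap.smulRight (a i)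
  let Lc : Euc n →L[ℝ] Euc n := LinearMap.toContinuousLinearMap Ll
  have hL : ∀ c : Euc n, Lc c = ∑ i, c i • a i := by
    intro c
    simp [Lc, Ll]
  -- The Gram matrix of the simple roots. The vector sought minimises its quadratic form on the unit
  -- sphere.
  let T : Euc n →L[ℝ] Euc n := (ContinuousLinearMap.adjoint Lc).comp Lc
  have hT : IsSelfAdjoint T := by
    rw [ContinuousLinearMap.isSelfAdjoint_iff']
    simp [T, ContinuousLinearMap.adjoint_comp]
  have hTin : ∀ x : Euc n, T.reApplyInnerSelf x = inner ℝ (Lc x) (Lc x) := by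
    intro x
    simp [ContinuousLinearMap.reApplyInnerSelf, T, ContinuousLinearMap.adjoint_inner_left]
  have hTi : ∀ (x : Euc n) (i : Fin n), (T x) i = inner ℝ (a i) (Lc x) := by
    intro x i
    have h1 : inner ℝ (EuclideanSpace.single i (1 : ℝ)) (T x) = (T x) i := by
      simp [EuclideanSpace.inner_single_left]
    rw [← h1]
    simp only [T, ContinuousLinearMap.comp_apply, ContinuousLinearMap.adjoint_inner_right]
    congr 1
    rw [hL, Finset.sum_eq_single i]
    · simp
    · intro j _ hj; simp [hj]
    · simp
  have hne : (Metric.sphere (0 : Euc n) 1).Nonempty := ⟨a 0, by simpa using (ha.isRoot 0).1⟩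
  obtain ⟨x, hx, hmin⟩ := (isCompact_sphere (0 : Euc n) 1).exists_isMinOn hne
    T.reApplyInnerSelf_continuous.continuousOn
  -- The off-diagonal Gram entries are nonpositive, so replacing coordinates by absolute values does
  -- not increase the quadratic form.
  let y : Euc n := WithLp.toLp 2 fun i => |x i|
  have hy : ‖y‖ = 1 := by
    have : ‖x‖ = 1 := by simpa using hx
    rw [← this, EuclideanSpace.norm_eq, EuclideanSpace.norm_eq]
    simp [y]
  have hyx : T.reApplyInnerSelf y ≤ T.reApplyInnerSelf x := by
    rw [hTin, hTin, hL, hL]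
    simp only [sum_inner, inner_sum, inner_smul_left, inner_smul_right, Finset.mul_sum]
    refine Finset.sum_le_sum fun i _ => Finset.sum_le_sum fun j _ => ?_
    simp only [y, conj_trivial]
    rcases eq_or_ne i j with rfl | hij
    · rw [← mul_assoc, ← mul_assoc, abs_mul_abs_self]
    · rw [← mul_assoc, ← mul_assoc, ← abs_mul]
      exact mul_le_mul_of_nonpos_right (le_abs_self _) (ha.inner_nonpos hij.symm)
  have hymin : IsMinOn T.reApplyInnerSelf (Metric.sphere 0 ‖y‖) y := by
    rw [hy]
    intro z hz
    exact hyx.trans (hmin hz)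
  have hy0 : y ≠ 0 := by
    intro h; rw [h] at hy; simp at hy
  have heig := hT.eq_smul_self_of_isLocalExtrOn (Or.inl hymin.localize)
  set lam := T.rayleighQuotient y with hlam
  have hy_nonneg : ∀ i, 0 ≤ y i := fun i => abs_nonneg _
  have heq : ∀ i, inner ℝ (a i) (∑ j, y j • a j) = lam * y i := by
    intro i
    rw [← hL, ← hTi, heig]
    simp
  refine ⟨fun i => y i, lam, ?_, ?_, heq⟩
  · by_contra! hcon
    obtain ⟨j, hj⟩ := hcon
    have hj0 : y j = 0 := le_antisymm hj (hy_nonneg j)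
    have hA1 : {i | y i ≠ 0}.Nonempty := by
      by_contra h
      rw [Set.not_nonempty_iff_eq_empty] at h
      apply hy0
      ext i
      by_contra hi
      exact (Set.ext_iff.1 h i).1 hi
    -- At a zero coordinate `k` adjacent to a nonzero one, the eigenvalue equation is a vanishing
    -- sum of nonpositive terms, one of them nonzero.
    obtain ⟨i, hi, k, hk, hik⟩ := ha.exists_inner_ne_zero hW hA1
      ((Set.ne_univ_iff_exists_notMem _).2 ⟨j, fun h => h hj0⟩)
    have hk0 : y k = 0 := by simpa using hk
    have h1 := heq k
    rw [hk0, mul_zero, inner_sum] at h1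
    have h2 : ∀ l ∈ Finset.univ, inner ℝ (a k) (y l • a l) ≤ 0 := by
      intro l _
      rw [inner_smul_right]
      rcases eq_or_ne k l with rfl | hkl
      · rw [hk0, zero_mul]
      · exact mul_nonpos_of_nonneg_of_nonpos (hy_nonneg l) (ha.inner_nonpos hkl)
    have h3 := (Finset.sum_eq_zero_iff_of_nonpos h2).1 h1 i (Finset.mem_univ _)
    rw [inner_smul_right, mul_eq_zero] at h3
    rcases h3 with h3 | h3
    · exact hi h3
    · exact hik (by rw [real_inner_comm]; exact h3)
  · have h1 : inner ℝ (Lc y) (Lc y) = lam := by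
      rw [← hTin, hlam]
      simp [ContinuousLinearMap.rayleighQuotient, hy]
    rw [← h1, real_inner_self_pos, hL]
    intro h
    apply hy0
    ext i
    have := congrArg (ha.coord i) h
    rwa [ha.coord_sum, map_zero] at this

end

/-! ### The Coxeter plane -/

section

variable {n : ℕ} [NeZero n] {W : Subgroup (Orth n)} {a : Fin n → Euc n}

theorem prefixProd_mem (ha : IsSimpleSystem W a) (k : ℕ) : prefixProd a k ∈ W := by
  induction k with
  | zero => exact W.one_mem
  | succ k ih => exact W.mul_mem ih (ha.isRoot _).2

theorem IsSimpleSystem.isRoot_rho (ha : IsSimpleSystem W a) (k : ℕ) : IsRoot W (rho a k) :=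
  (ha.isRoot _).map (prefixProd_mem ha k)

theorem prefixProd_succ_apply (k : ℕ) (v : Euc n) :
    prefixProd a (k + 1) v = prefixProd a k (refl (a (Fin.ofNat n k)) v) := rfl

theorem ofNat_add_self (k : ℕ) : Fin.ofNat n (n + k) = Fin.ofNat n k := by
  ext; simp

theorem ofNat_mul_add (k r : ℕ) : Fin.ofNat n (k * n + r) = Fin.ofNat n r := by
  ext; simp

theorem prefixProd_period (k : ℕ) : prefixProd a (n + k) = cox a * prefixProd a k := by
  induction k with
  | zero => simp [cox, prefixProd]
  | succ k ih =>
    change prefixProd a (n + k) * refl (a (Fin.ofNat n (n + k))) = _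
    rw [ih, ofNat_add_self, mul_assoc]
    rfl

theorem prefixProd_mul_add (k r : ℕ) :
    prefixProd a (k * n + r) = cox a ^ k * prefixProd a r := by
  induction k with
  | zero => simp
  | succ k ih =>
    rw [show (k + 1) * n + r = n + (k * n + r) by ring, prefixProd_period, ih, pow_succ', mul_assoc]

theorem prefixProd_eq_list_prod (a : Fin n → Euc n) (k : ℕ) :
    prefixProd a k = (((List.range k).map (Fin.ofNat n)).map fun i => refl (a i)).prod := by
  induction k with
  | zero => rfl
  | succ k ih =>
    rw [List.range_succ]
    simp only [List.map_append, List.prod_append, List.map_cons, List.map_nil, List.prod_cons,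
      List.prod_nil, mul_one]
    rw [← ih]
    rfl

/-- The action of a product of consecutive, mutually orthogonal simple reflections. -/
theorem IsSimpleSystem.prefixProd_add_apply (ha : IsSimpleSystem W a) (i k : ℕ) (hk : i + k ≤ n)
    (horth : ∀ j l : Fin n, j ≠ l → i ≤ j → (j : ℕ) < i + k → i ≤ l → (l : ℕ) < i + k →
      inner ℝ (a j) (a l) = 0) (v : Euc n) :
    ∃ u, prefixProd a (i + k) v = prefixProd a i u ∧
      (∀ j : Fin n, i ≤ j → (j : ℕ) < i + k → ha.coord j u = ha.coord j v - 2 * inner ℝ (a j) v) ∧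
      ∀ j : Fin n, ¬ (i ≤ j ∧ (j : ℕ) < i + k) → ha.coord j u = ha.coord j v := by
  induction k generalizing v with
  | zero => exact ⟨v, rfl, fun j h1 h2 => by omega, fun _ _ => rfl⟩
  | succ k ih =>
    set m : Fin n := Fin.ofNat n (i + k) with hm
    have hmv : (m : ℕ) = i + k := by simp [hm, Nat.mod_eq_of_lt (show i + k < n by omega)]
    obtain ⟨u, h1, h2, h3⟩ := ih (by omega)
      (fun j l hjl a1 a2 a3 a4 => horth j l hjl a1 (by omega) a3 (by omega)) (refl (a m) v)
    refine ⟨u, h1, fun j hj1 hj2 => ?_, fun j hj => ?_⟩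
    · rcases eq_or_ne j m with rfl | hjm
      · rw [h3 m (by omega), ha.coord_refl_self]
      · have : (j : ℕ) ≠ m := fun h => hjm (Fin.ext h)
        rw [h2 j hj1 (by omega), ha.coord_refl_of_ne hjm, refl_apply (ha.isRoot m).1, inner_sub_right,
          inner_smul_right, horth j m hjm hj1 hj2 (by omega) (by omega), mul_zero, sub_zero]
    · rw [h3 j (by omega), ha.coord_refl_of_ne]
      rintro rfl
      omega

/-- In the bipartite case a positive root supported in one of the two blocks is simple. -/
theorem IsSimpleSystem.eq_simple_of_support (ha : IsSimpleSystem W a) {A : Set (Fin n)}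
    (hA : ∀ i ∈ A, ∀ j ∈ A, i ≠ j → inner ℝ (a i) (a j) = 0) {v : Euc n}
    (hv : IsPositiveRoot W a v) (h : ∀ i ∉ A, ha.coord i v = 0) : ∃ i ∈ A, v = a i := by
  obtain ⟨i, hi⟩ : ∃ i, ha.coord i v ≠ 0 := by
    by_contra! h0
    exact hv.1.ne_zero (ha.ext_coord fun i => by rw [h0 i, map_zero])
  have hiA : i ∈ A := by
    by_contra h'
    exact hi (h i h')
  have hpos : 0 < ha.coord i v := lt_of_le_of_ne ((ha.isNonnegComb_iff _).1 hv.2 i) hi.symm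
  refine ⟨i, hiA, ha.eq_simple hv fun hp => ?_⟩
  have h1 := (ha.isNonnegComb_iff _).1 hp.2 i
  have h2 : inner ℝ (a i) v = ha.coord i v := by
    conv_lhs => rw [← ha.sum_coord v]
    rw [inner_sum, Finset.sum_eq_single i]
    · rw [inner_smul_right, real_inner_self_eq_norm_sq, (ha.isRoot i).1]; norm_num
    · intro l _ hl
      rw [inner_smul_right]
      by_cases hlA : l ∈ A
      · rw [hA i hiA l hlA hl.symm, mul_zero]
      · rw [h l hlA, zero_mul]
    · simp
  rw [ha.coord_refl_self, h2] at h1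
  linarith

/-- With an empty block all simple roots would be mutually orthogonal, contradicting connectedness
of the Coxeter graph. -/
theorem IsSimpleSystem.block_sizes (ha : IsSimpleSystem W a)
    (hW : IsFiniteIrreducibleReflectionGroup W) (hn : 2 ≤ n) {s : ℕ} (hs : IsBipartite a s) :
    0 < s ∧ s < n := by
  obtain ⟨i, hi, j, hj, hij⟩ := ha.exists_inner_ne_zero hW (A := {0}) ⟨0, rfl⟩ (by
    intro h
    have : (⟨1, by omega⟩ : Fin n) ∈ ({0} : Set (Fin n)) := h ▸ Set.mem_univ _
    simp [Fin.ext_iff] at this)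
  have hne : i ≠ j := fun h => hj (h ▸ hi)
  have h1 := mt (hs.2 i j hne) hij
  have h2 := hs.1
  constructor
  · by_contra h
    exact h1 (by omega)
  · by_contra h
    exact h1 (by omega)

/-- Two linear functionals, nonnegative on positive roots, on which the group generated by the two
blocks of simple reflections acts as a planar dihedral group with angle `θ`. -/
structure IsCoxeterPlane (W : Subgroup (Orth n)) (a : Fin n → Euc n) (s : ℕ)
    (p q : Euc n →ₗ[ℝ] ℝ) (θ : ℝ) : Prop where
  theta_pos : 0 < θ
  theta_le : θ ≤ Real.pi / 2
  nonneg_left : ∀ v, IsPositiveRoot W a v → 0 ≤ p v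
  nonneg_right : ∀ v, IsPositiveRoot W a v → 0 ≤ q v
  add_pos : ∀ v, IsPositiveRoot W a v → 0 < p v + q v
  simple_left : ∀ j : Fin n, (j : ℕ) < s → 0 < p (a j) ∧ q (a j) = 0
  simple_right : ∀ j : Fin n, s ≤ (j : ℕ) → p (a j) = 0 ∧ 0 < q (a j)
  eq_simple_right : ∀ v, IsPositiveRoot W a v → p v = 0 → ∃ j : Fin n, s ≤ (j : ℕ) ∧ v = a j
  eq_simple_left : ∀ v, IsPositiveRoot W a v → q v = 0 → ∃ j : Fin n, (j : ℕ) < s ∧ v = a j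
  left_prefix : ∀ v, p (prefixProd a s v) = 2 * Real.cos θ * q v - p v
  right_prefix : ∀ v, q (prefixProd a s v) = q v
  left_cox : ∀ v, p (cox a v) = 2 * Real.cos θ * (2 * Real.cos θ * p v - q v) - p v
  right_cox : ∀ v, q (cox a v) = 2 * Real.cos θ * p v - q v

theorem IsSimpleSystem.exists_isCoxeterPlane (ha : IsSimpleSystem W a)
    (hW : IsFiniteIrreducibleReflectionGroup W) (hn : 2 ≤ n) {s : ℕ} (hs : IsBipartite a s) :
    ∃ p q θ, IsCoxeterPlane W a s p q θ := by
  obtain ⟨hs0, hsn⟩ := ha.block_sizes hW hn hs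
  obtain ⟨c, lam, hc, hlam, hperron⟩ := ha.exists_perron hW
  let I : Finset (Fin n) := Finset.univ.filter fun j => (j : ℕ) < s
  let J : Finset (Fin n) := Finset.univ.filter fun j => ¬ (j : ℕ) < s
  let p : Euc n →ₗ[ℝ] ℝ := ∑ j ∈ I, c j • ha.coord j
  let q : Euc n →ₗ[ℝ] ℝ := ∑ j ∈ J, c j • ha.coord j
  have hp : ∀ v, p v = ∑ j ∈ I, c j * ha.coord j v := fun v => by simp [p]
  have hq : ∀ v, q v = ∑ j ∈ J, c j * ha.coord j v := fun v => by simp [q]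
  have hIJ : ∀ f : Fin n → ℝ, ∑ j, f j = ∑ j ∈ I, f j + ∑ j ∈ J, f j := fun f =>
    (Finset.sum_filter_add_sum_filter_not _ _ _).symm
  have hIJ' : ∀ f : Fin n → Euc n, ∑ j, f j = ∑ j ∈ I, f j + ∑ j ∈ J, f j := fun f =>
    (Finset.sum_filter_add_sum_filter_not _ _ _).symm
  have hI : ∀ j, j ∈ I ↔ (j : ℕ) < s := fun j => by simp [I]
  have hJ : ∀ j, j ∈ J ↔ ¬ (j : ℕ) < s := fun j => by simp [J]
  -- The Perron vector is `x + y`, split along the blocks. The eigenvalue equation makes ⟨x, ·⟩ and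
  -- ⟨y, ·⟩ combinations of `p` and `q`, so the block products act on the pair (p, q).
  set x : Euc n := ∑ j ∈ I, c j • a j with hx
  set y : Euc n := ∑ j ∈ J, c j • a j with hy
  have hone : ∀ j, inner ℝ (a j) (a j) = 1 := fun j => by
    rw [real_inner_self_eq_norm_sq, (ha.isRoot j).1]; norm_num
  have hIx : ∀ j ∈ I, inner ℝ (a j) x = c j := by
    intro j hj
    rw [hx, inner_sum, Finset.sum_eq_single j]
    · rw [inner_smul_right, hone, mul_one]
    · intro l hl hlj
      rw [hI] at hj hl
      rw [inner_smul_right, hs.2 j l hlj.symm (by tauto), mul_zero]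
    · exact fun h => absurd hj h
  have hJy : ∀ j ∈ J, inner ℝ (a j) y = c j := by
    intro j hj
    rw [hy, inner_sum, Finset.sum_eq_single j]
    · rw [inner_smul_right, hone, mul_one]
    · intro l hl hlj
      rw [hJ] at hj hl
      rw [inner_smul_right, hs.2 j l hlj.symm (by tauto), mul_zero]
    · exact fun h => absurd hj h
  have hsum : ∀ j, inner ℝ (a j) x + inner ℝ (a j) y = lam * c j := by
    intro j
    rw [← inner_add_right, ← hperron j, hIJ']
  have hJx : ∀ j ∈ J, inner ℝ (a j) x = -((1 - lam) * c j) := by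
    intro j hj
    have := hsum j
    rw [hJy j hj] at this
    linarith
  have hIy : ∀ j ∈ I, inner ℝ (a j) y = -((1 - lam) * c j) := by
    intro j hj
    have := hsum j
    rw [hIx j hj] at this
    linarith
  have hxv : ∀ v, inner ℝ x v = p v - (1 - lam) * q v := by
    intro v
    conv_lhs => rw [← ha.sum_coord v]
    rw [inner_sum, hIJ, hp, hq, Finset.mul_sum, sub_eq_add_neg, ← Finset.sum_neg_distrib]
    congr 1
    · refine Finset.sum_congr rfl fun j hj => ?_
      rw [inner_smul_right, real_inner_comm, hIx j hj]; ring
    · refine Finset.sum_congr rfl fun j hj => ?_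
      rw [inner_smul_right, real_inner_comm, hJx j hj]; ring
  have hyv : ∀ v, inner ℝ y v = q v - (1 - lam) * p v := by
    intro v
    conv_lhs => rw [← ha.sum_coord v]
    rw [inner_sum, hIJ, hp, hq, Finset.mul_sum, sub_eq_add_neg, ← Finset.sum_neg_distrib, add_comm]
    congr 1
    · refine Finset.sum_congr rfl fun j hj => ?_
      rw [inner_smul_right, real_inner_comm, hJy j hj]; ring
    · refine Finset.sum_congr rfl fun j hj => ?_
      rw [inner_smul_right, real_inner_comm, hIy j hj]; ring
  have hkap : lam ≤ 1 := by
    set i : Fin n := ⟨0, by omega⟩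
    have hi : i ∈ I := (hI i).2 hs0
    have h1 := hIy i hi
    have h2 : inner ℝ (a i) y ≤ 0 := by
      rw [hy, inner_sum]
      refine Finset.sum_nonpos fun j hj => ?_
      rw [inner_smul_right]
      refine mul_nonpos_of_nonneg_of_nonpos (hc j).le (ha.inner_nonpos ?_)
      rintro rfl
      exact (hJ _).1 hj ((hI _).1 hi)
    rw [h1] at h2
    have := hc i
    by_contra! hl
    nlinarith
  -- Since 0 < `lam` ≤ 1, the cosine lies in [0, 1) and θ in (0, π/2].
  set θ := Real.arccos (1 - lam) with hθ
  have hcos : Real.cos θ = 1 - lam := Real.cos_arccos (by linarith) (by linarith)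
  have hleft : ∀ v, p (prefixProd a s v) = 2 * Real.cos θ * q v - p v ∧
      q (prefixProd a s v) = q v := by
    intro v
    obtain ⟨u, h1, h2, h3⟩ := ha.prefixProd_add_apply 0 s (by omega)
      (fun j l hjl _ h1 _ h2 => hs.2 j l hjl (by omega)) v
    rw [zero_add] at h1
    have h1' : prefixProd a s v = u := h1
    rw [h1', hcos]
    constructor
    · have : p u = p v - 2 * inner ℝ x v := by
        rw [hp, hp, hx, sum_inner, Finset.mul_sum, ← Finset.sum_sub_distrib]
        refine Finset.sum_congr rfl fun j hj => ?_
        rw [h2 j (by omega) (by rw [zero_add]; exact (hI j).1 hj), inner_smul_left]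
        simp only [conj_trivial]
        ring
      rw [this, hxv]
      ring
    · rw [hq, hq]
      refine Finset.sum_congr rfl fun j hj => ?_
      rw [h3 j (by have := (hJ j).1 hj; omega)]
  have hright : ∀ v, ∃ u, cox a v = prefixProd a s u ∧
      q u = 2 * Real.cos θ * p v - q v ∧ p u = p v := by
    intro v
    obtain ⟨u, h1, h2, h3⟩ := ha.prefixProd_add_apply s (n - s) (by omega)
      (fun j l hjl _ h1 _ h2 => hs.2 j l hjl (by omega)) v
    rw [Nat.add_sub_cancel' hsn.le] at h1 h2 h3
    refine ⟨u, h1, ?_, ?_⟩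
    · have : q u = q v - 2 * inner ℝ y v := by
        rw [hq, hq, hy, sum_inner, Finset.mul_sum, ← Finset.sum_sub_distrib]
        refine Finset.sum_congr rfl fun j hj => ?_
        rw [h2 j (by have := (hJ j).1 hj; omega) j.2, inner_smul_left]
        simp only [conj_trivial]
        ring
      rw [this, hyv, hcos]
      ring
    · rw [hp, hp]
      refine Finset.sum_congr rfl fun j hj => ?_
      rw [h3 j (by have := (hI j).1 hj; omega)]
  have hnn : ∀ v, IsPositiveRoot W a v → ∀ j, 0 ≤ c j * ha.coord j v := fun v hv j =>
    mul_nonneg (hc j).le ((ha.isNonnegComb_iff _).1 hv.2 j)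
  have hpnn : ∀ v, IsPositiveRoot W a v → 0 ≤ p v := fun v hv => by
    rw [hp]; exact Finset.sum_nonneg fun j _ => hnn v hv j
  have hqnn : ∀ v, IsPositiveRoot W a v → 0 ≤ q v := fun v hv => by
    rw [hq]; exact Finset.sum_nonneg fun j _ => hnn v hv j
  have hp0 : ∀ v, IsPositiveRoot W a v → p v = 0 → ∀ j ∈ I, ha.coord j v = 0 := by
    intro v hv h j hj
    rw [hp] at h
    have := (Finset.sum_eq_zero_iff_of_nonneg fun j _ => hnn v hv j).1 h j hj
    exact (mul_eq_zero.1 this).resolve_left (hc j).ne'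
  have hq0 : ∀ v, IsPositiveRoot W a v → q v = 0 → ∀ j ∈ J, ha.coord j v = 0 := by
    intro v hv h j hj
    rw [hq] at h
    have := (Finset.sum_eq_zero_iff_of_nonneg fun j _ => hnn v hv j).1 h j hj
    exact (mul_eq_zero.1 this).resolve_left (hc j).ne'
  have hpa : ∀ i, p (a i) = if i ∈ I then c i else 0 := by
    intro i
    have : ∀ j ∈ I, c j * ha.coord j (a i) = if i = j then c j else 0 := by
      intro j _
      split_ifs with h
      · rw [h, ha.coord_self, mul_one]
      · rw [ha.coord_of_ne (Ne.symm h), mul_zero]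
    rw [hp, Finset.sum_congr rfl this, Finset.sum_ite_eq]
  have hqa : ∀ i, q (a i) = if i ∈ J then c i else 0 := by
    intro i
    have : ∀ j ∈ J, c j * ha.coord j (a i) = if i = j then c j else 0 := by
      intro j _
      split_ifs with h
      · rw [h, ha.coord_self, mul_one]
      · rw [ha.coord_of_ne (Ne.symm h), mul_zero]
    rw [hq, Finset.sum_congr rfl this, Finset.sum_ite_eq]
  refine ⟨p, q, θ, ?_⟩
  constructor
  · exact Real.arccos_pos.2 (by linarith)
  · exact Real.arccos_le_pi_div_two.2 (by linarith)
  · exact hpnn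
  · exact hqnn
  · intro v hv
    refine lt_of_le_of_ne (add_nonneg (hpnn v hv) (hqnn v hv)) fun h => hv.1.ne_zero ?_
    have h1 := hpnn v hv
    have h2 := hqnn v hv
    refine ha.ext_coord fun j => ?_
    rw [map_zero]
    by_cases hj : (j : ℕ) < s
    · exact hp0 v hv (by linarith) j ((hI j).2 hj)
    · exact hq0 v hv (by linarith) j ((hJ j).2 hj)
  · intro j hj
    rw [hpa, hqa, if_pos ((hI j).2 hj), if_neg fun h => (hJ j).1 h hj]
    exact ⟨hc j, rfl⟩
  · intro j hj
    rw [hpa, hqa, if_pos ((hJ j).2 (by omega)), if_neg fun h => absurd ((hI j).1 h) (by omega)]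
    exact ⟨rfl, hc j⟩
  · intro v hv h
    obtain ⟨j, hj, hvj⟩ := ha.eq_simple_of_support (A := {j | s ≤ (j : ℕ)})
      (fun i hi j hj hij => hs.2 i j hij (by simp at hi hj; omega)) hv
      (fun i hi => hp0 v hv h i ((hI i).2 (by simpa using hi)))
    exact ⟨j, hj, hvj⟩
  · intro v hv h
    obtain ⟨j, hj, hvj⟩ := ha.eq_simple_of_support (A := {j | (j : ℕ) < s})
      (fun i hi j hj hij => hs.2 i j hij (by simp at hi hj; omega)) hv
      (fun i hi => hq0 v hv h i ((hJ i).2 (by simpa using hi)))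
    exact ⟨j, hj, hvj⟩
  · exact fun v => (hleft v).1
  · exact fun v => (hleft v).2
  · intro v
    obtain ⟨u, h1, h2, h3⟩ := hright v
    rw [h1, (hleft u).1, h2, h3]
  · intro v
    obtain ⟨u, h1, h2, h3⟩ := hright v
    rw [h1, (hleft u).2, h2]

end

/-! ### Steinberg's theorem: the order of the Coxeter element and its half power -/

section

variable {n : ℕ} [NeZero n] {W : Subgroup (Orth n)} {a : Fin n → Euc n}

theorem IsSimpleSystem.prefixProd_add_of_inner_eq_zero (ha : IsSimpleSystem W a) (i k : ℕ)
    {v : Euc n} (h : ∀ l, i ≤ l → l < i + k → inner ℝ (a (Fin.ofNat n l)) v = 0) :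
    prefixProd a (i + k) v = prefixProd a i v := by
  induction k with
  | zero => rfl
  | succ k ih =>
    rw [← Nat.add_assoc, prefixProd_succ_apply,
      refl_of_inner_eq_zero (ha.isRoot _).1 (h (i + k) (by omega) (by omega)),
      ih fun l h1 h2 => h l h1 (by omega)]

theorem ofNat_val (j : Fin n) : Fin.ofNat n (j : ℕ) = j := by
  ext; simp

theorem val_ofNat {l : ℕ} (h : l < n) : ((Fin.ofNat n l : Fin n) : ℕ) = l := by
  simp [Nat.mod_eq_of_lt h]

/-- Earlier reflections of the same block fix `a j`, so only full turns of γ remain; for the second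
block in `rho_right` the first-block product remains as well. -/
theorem IsSimpleSystem.rho_left (ha : IsSimpleSystem W a) {s : ℕ} (hs : IsBipartite a s) (k : ℕ)
    (j : Fin n) (hj : (j : ℕ) < s) : rho a (k * n + j) = (cox a ^ k) (a j) := by
  rw [rho, prefixProd_mul_add, ofNat_mul_add, ofNat_val]
  change (cox a ^ k) (prefixProd a j (a j)) = _
  congr 1
  have := ha.prefixProd_add_of_inner_eq_zero 0 j (v := a j) fun l _ hl => by
    have hl' := val_ofNat (n := n) (l := l) (by omega)
    exact hs.2 _ _ (fun h => by rw [h] at hl'; omega) (by omega)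
  rw [zero_add] at this
  exact this

theorem IsSimpleSystem.rho_right (ha : IsSimpleSystem W a) {s : ℕ} (hs : IsBipartite a s) (k : ℕ)
    (j : Fin n) (hj : s ≤ (j : ℕ)) :
    rho a (k * n + j) = (cox a ^ k) (prefixProd a s (a j)) := by
  rw [rho, prefixProd_mul_add, ofNat_mul_add, ofNat_val]
  change (cox a ^ k) (prefixProd a j (a j)) = _
  congr 1
  have := ha.prefixProd_add_of_inner_eq_zero s (j - s) (v := a j) fun l _ hl => by
    have hl' := val_ofNat (n := n) (l := l) (by omega)
    exact hs.2 _ _ (fun h => by rw [h] at hl'; omega) (by omega)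
  rw [Nat.add_sub_cancel' hj] at this
  exact this

namespace IsCoxeterPlane

variable {s : ℕ} {p q : Euc n →ₗ[ℝ] ℝ} {θ : ℝ}

theorem sin_pos (h : IsCoxeterPlane W a s p q θ) : 0 < Real.sin θ :=
  Real.sin_pos_of_pos_of_lt_pi h.theta_pos (by linarith [h.theta_le, Real.pi_pos])

/-- On (p, q) the Coxeter element has determinant 1 and trace 2 cos 2θ: it is conjugate to the
rotation by 2θ. The factor sin θ clears the denominators of its powers. -/
theorem cox_pow (h : IsCoxeterPlane W a s p q θ) (k : ℕ) (v : Euc n) :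
    Real.sin θ * p ((cox a ^ k) v) = Real.sin (2 * k * θ + θ) * p v - Real.sin (2 * k * θ) * q v ∧
    Real.sin θ * q ((cox a ^ k) v) =
      Real.sin (2 * k * θ) * p v - Real.sin (2 * k * θ - θ) * q v := by
  induction k with
  | zero => simp
  | succ k ih =>
    obtain ⟨h1, h2⟩ := ih
    have hk : (cox a ^ (k + 1)) v = cox a ((cox a ^ k) v) := by
      rw [pow_succ']; rfl
    have e : 2 * ((k + 1 : ℕ) : ℝ) * θ = 2 * k * θ + 2 * θ := by push_cast; ring
    have hsc := Real.sin_sq_add_cos_sq θ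
    rw [hk, h.left_cox, h.right_cox, e]
    generalize 2 * (k : ℝ) * θ = X at *
    simp only [Real.sin_add, Real.sin_sub, Real.sin_two_mul, Real.cos_two_mul, Real.cos_add] at *
    generalize p ((cox a ^ k) v) = P at *
    generalize q ((cox a ^ k) v) = Q at *
    constructor
    · linear_combination (4 * Real.cos θ ^ 2 - 1) * h1 - 2 * Real.cos θ * h2 +
        2 * Real.cos θ * Real.sin X * p v * hsc
    · linear_combination 2 * Real.cos θ * h1 - h2 + 2 * Real.cos θ * Real.sin X * q v * hsc

theorem cox_pow_prefix (h : IsCoxeterPlane W a s p q θ) (k : ℕ) (v : Euc n) :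
    Real.sin θ * p ((cox a ^ k) (prefixProd a s v)) =
      Real.sin (2 * k * θ + 2 * θ) * q v - Real.sin (2 * k * θ + θ) * p v ∧
    Real.sin θ * q ((cox a ^ k) (prefixProd a s v)) =
      Real.sin (2 * k * θ + θ) * q v - Real.sin (2 * k * θ) * p v := by
  obtain ⟨h1, h2⟩ := h.cox_pow k (prefixProd a s v)
  rw [h1, h2, h.left_prefix, h.right_prefix]
  generalize 2 * (k : ℝ) * θ = X at *
  simp only [Real.sin_add, Real.sin_sub, Real.sin_two_mul, Real.cos_two_mul]
  constructor <;> ring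

theorem isPositiveRoot (h : IsCoxeterPlane W a s p q θ) (ha : IsSimpleSystem W a) {v : Euc n}
    (hv : IsRoot W v) (hpq : 0 < p v ∨ 0 < q v) : IsPositiveRoot W a v := by
  refine (ha.pos_or_neg hv).resolve_right fun hn => ?_
  have h1 := h.nonneg_left _ hn
  have h2 := h.nonneg_right _ hn
  rw [map_neg] at h1 h2
  rcases hpq with h3 | h3 <;> linarith

/-- The angle of the Coxeter plane divides `π`. -/
theorem exists_angle (h : IsCoxeterPlane W a s p q θ) (ha : IsSimpleSystem W a) (hs0 : 0 < s)
    (hsn : s < n) : ∃ m : ℕ, 2 ≤ m ∧ m * θ = Real.pi := by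
  have hθ := h.theta_pos
  have hle := h.theta_le
  have hsin := h.sin_pos
  have hm2 : 2 ≤ Real.pi / θ := by rw [le_div_iff₀ hθ]; linarith
  have hceil := Nat.le_ceil (Real.pi / θ)
  have hlt := Nat.ceil_lt_add_one (a := Real.pi / θ) (by linarith)
  -- If mθ > π, then (m - 1)θ < π < mθ, and rotating a simple root yields a root with `p` < 0 < `q`,
  -- which is neither positive nor negative. The parity of `m` decides which block supplies it.
  set m := ⌈Real.pi / θ⌉₊
  have hm : 2 ≤ m := by
    have : (2 : ℝ) ≤ m := hm2.trans hceil
    exact_mod_cast this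
  refine ⟨m, hm, ?_⟩
  have h1 : Real.pi ≤ m * θ := by rwa [div_le_iff₀ hθ] at hceil
  have h2 : m * θ - θ < Real.pi := by
    have : (m : ℝ) - 1 < Real.pi / θ := by linarith
    rw [lt_div_iff₀ hθ] at this
    linarith
  refine le_antisymm ?_ h1
  by_contra! h3
  have hneg : Real.sin (m * θ) < 0 := by
    have := Real.sin_pos_of_pos_of_lt_pi (x := m * θ - Real.pi) (by linarith) (by linarith)
    rw [Real.sin_sub_pi] at this
    linarith
  have hpos : 0 < Real.sin (m * θ - θ) := by
    refine Real.sin_pos_of_pos_of_lt_pi ?_ h2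
    linarith [Real.pi_pos]
  have contra : ∀ v, IsRoot W v → Real.sin θ * p v < 0 → 0 < Real.sin θ * q v → False := by
    intro v hv h4 h5
    have h6 : 0 < q v := by
      by_contra! h'; nlinarith
    have h7 := h.nonneg_left v (h.isPositiveRoot ha hv (Or.inr h6))
    nlinarith
  rcases Nat.even_or_odd' m with ⟨k, hk | hk⟩
  · obtain ⟨k, rfl⟩ : ∃ k', k = k' + 1 := ⟨k - 1, by omega⟩
    set j : Fin n := ⟨s, hsn⟩
    have hj := h.simple_right j le_rfl
    obtain ⟨e1, e2⟩ := h.cox_pow_prefix k (a j)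
    have e3 : 2 * (k : ℝ) * θ + 2 * θ = m * θ := by rw [hk]; push_cast; ring
    have e4 : 2 * (k : ℝ) * θ + θ = m * θ - θ := by rw [hk]; push_cast; ring
    rw [e3, e4, hj.1] at e1
    rw [e4, hj.1] at e2
    refine contra _ (((ha.isRoot j).map (prefixProd_mem ha s)).map
      (W.pow_mem (prefixProd_mem ha n) k)) ?_ ?_
    · change Real.sin θ * p ((cox a ^ k) _) < 0
      rw [e1]; nlinarith [hj.2]
    · change 0 < Real.sin θ * q ((cox a ^ k) _)
      rw [e2]; nlinarith [hj.2]
  · set j : Fin n := ⟨0, by omega⟩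
    have hj := h.simple_left j hs0
    obtain ⟨e1, e2⟩ := h.cox_pow k (a j)
    have e3 : 2 * (k : ℝ) * θ + θ = m * θ := by rw [hk]; push_cast; ring
    have e4 : 2 * (k : ℝ) * θ = m * θ - θ := by rw [hk]; push_cast; ring
    rw [e3, hj.2] at e1
    rw [e4, hj.2] at e2
    refine contra _ ((ha.isRoot j).map (W.pow_mem (prefixProd_mem ha n) k)) ?_ ?_
    · change Real.sin θ * p ((cox a ^ k) _) < 0
      rw [e1]; nlinarith [hj.1]
    · change 0 < Real.sin θ * q ((cox a ^ k) _)
      rw [e2]; nlinarith [hj.1]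

/-- The order of the Coxeter element is determined by the angle of the Coxeter plane. -/
theorem orderOf_cox (h : IsCoxeterPlane W a s p q θ) (ha : IsSimpleSystem W a) (hs0 : 0 < s)
    {m : ℕ} (hm : 2 ≤ m) (hmθ : m * θ = Real.pi) : orderOf (cox a) = m := by
  have hsin := h.sin_pos
  have hθ := h.theta_pos
  rw [orderOf_eq_iff (by omega)]
  constructor
  · have e : 2 * (m : ℝ) * θ = 2 * Real.pi := by rw [mul_assoc, hmθ]
    have hpow : cox a ^ m =
        (((List.range (m * n)).map (Fin.ofNat n)).map fun i => refl (a i)).prod := by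
      rw [← prefixProd_eq_list_prod, ← Nat.add_zero (m * n), prefixProd_mul_add]
      simp [prefixProd]
    rw [hpow]
    -- The `m`-th power is trivial on (p, q), so it keeps every simple root positive.
    refine ha.prod_eq_one _ fun i => ?_
    rw [← hpow]
    obtain ⟨e1, e2⟩ := h.cox_pow m (a i)
    rw [e, add_comm, Real.sin_add_two_pi, Real.sin_two_pi, zero_mul, sub_zero] at e1
    rw [e, Real.sin_two_pi, Real.sin_two_pi_sub, zero_mul, zero_sub, neg_mul, neg_neg] at e2
    have h1 := mul_left_cancel₀ hsin.ne' e1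
    have h2 := mul_left_cancel₀ hsin.ne' e2
    have h3 := h.add_pos _ (ha.isPositiveRoot_simple i)
    refine h.isPositiveRoot ha ((ha.isRoot i).map (W.pow_mem (prefixProd_mem ha n) m)) ?_
    rw [h1, h2]
    by_contra! h4
    linarith [h4.1, h4.2]
  · intro k hkm hk0 hone
    set j : Fin n := ⟨0, Nat.pos_of_ne_zero (NeZero.ne n)⟩
    have hj := h.simple_left j hs0
    obtain ⟨e1, e2⟩ := h.cox_pow k (a j)
    rw [hone, hj.2] at e1 e2
    change Real.sin θ * p (a j) = _ at e1
    change Real.sin θ * q (a j) = _ at e2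
    rw [hj.2, mul_zero, mul_zero, sub_zero, eq_comm, mul_eq_zero] at e2
    rw [mul_zero, sub_zero, Real.sin_add, e2.resolve_right hj.1.ne', zero_mul, zero_add] at e1
    have e3 : Real.cos (2 * k * θ) = 1 := by
      have := mul_right_cancel₀ hj.1.ne' e1
      have h2 : (Real.cos (2 * k * θ) - 1) * Real.sin θ = 0 := by linarith
      linarith [(mul_eq_zero.1 h2).resolve_right hsin.ne']
    have hkpos : (0 : ℝ) < k := by exact_mod_cast hk0
    have hklt : (k : ℝ) < m := by exact_mod_cast hkm
    have h5 : 2 * (k : ℝ) * θ < 2 * Real.pi := by rw [← hmθ]; nlinarith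
    have h6 : 0 < 2 * (k : ℝ) * θ := by positivity
    rw [Real.cos_eq_one_iff_of_lt_of_lt (by linarith [Real.pi_pos]) h5] at e3
    linarith

/-- For an odd Coxeter number the half power of the Coxeter element swaps the two blocks. -/
theorem half_pow_odd (h : IsCoxeterPlane W a s p q θ) {k : ℕ}
    (hmθ : ((2 * k + 1 : ℕ) : ℝ) * θ = Real.pi) (v : Euc n) :
    p ((cox a ^ k) (prefixProd a s v)) = - q v ∧ q ((cox a ^ k) (prefixProd a s v)) = - p v := by
  obtain ⟨e1, e2⟩ := h.cox_pow_prefix k v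
  have hsin := h.sin_pos
  push_cast at hmθ
  rw [show 2 * (k : ℝ) * θ + 2 * θ = θ + Real.pi by linarith, Real.sin_add_pi,
    show 2 * (k : ℝ) * θ + θ = Real.pi by linarith, Real.sin_pi] at e1
  rw [show 2 * (k : ℝ) * θ + θ = Real.pi by linarith, Real.sin_pi,
    show 2 * (k : ℝ) * θ = Real.pi - θ by linarith, Real.sin_pi_sub] at e2
  constructor
  · apply mul_left_cancel₀ hsin.ne'; linarith
  · apply mul_left_cancel₀ hsin.ne'; linarith

/-- The half power rotates the plane by 2kθ = π. -/
theorem half_pow_even (h : IsCoxeterPlane W a s p q θ) {k : ℕ}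
    (hmθ : ((2 * k : ℕ) : ℝ) * θ = Real.pi) (v : Euc n) :
    p ((cox a ^ k) v) = - p v ∧ q ((cox a ^ k) v) = - q v := by
  obtain ⟨e1, e2⟩ := h.cox_pow k v
  have hsin := h.sin_pos
  push_cast at hmθ
  rw [hmθ, Real.sin_pi, add_comm, Real.sin_add_pi] at e1
  rw [hmθ, Real.sin_pi, Real.sin_pi_sub] at e2
  constructor
  · apply mul_left_cancel₀ hsin.ne'; linarith
  · apply mul_left_cancel₀ hsin.ne'; linarith

/-- The negative of the half-turn element swaps `p` and `q`. Simple roots of a block are the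
positive roots killed by one of these functionals, so the blocks inject into each other. This makes
nh/2 = kn + s for h = 2k + 1. -/
theorem two_mul_block_of_odd (h : IsCoxeterPlane W a s p q θ) (ha : IsSimpleSystem W a)
    (hsn : s < n) {k : ℕ} (hmθ : ((2 * k + 1 : ℕ) : ℝ) * θ = Real.pi) :
    n = 2 * s := by
  have hw := h.half_pow_odd hmθ
  set w : Orth n := cox a ^ k * prefixProd a s with hwdef
  have hwW : w ∈ W := W.mul_mem (W.pow_mem (prefixProd_mem ha n) k) (prefixProd_mem ha s)
  replace hw : ∀ v, p (-w v) = q v ∧ q (-w v) = p v := fun v => by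
    rw [map_neg, map_neg, hwdef]
    have := hw v
    change -p ((cox a ^ k) (prefixProd a s v)) = _ ∧ -q ((cox a ^ k) (prefixProd a s v)) = _
    rw [this.1, this.2, neg_neg, neg_neg]
    exact ⟨rfl, rfl⟩
  have hroot : ∀ j, IsRoot W (-w (a j)) := fun j => ((ha.isRoot j).map hwW).neg
  have hinj : ∀ {i j l : Fin n}, -w (a i) = a l → -w (a j) = a l → i = j := by
    intro i j l hi hj
    exact ha.linearIndependent.injective (w.injective (neg_injective (hi.trans hj.symm)))
  have h1 : ∀ j : Fin n, (j : ℕ) < s → ∃ l : Fin n, s ≤ (l : ℕ) ∧ -w (a j) = a l := by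
    intro j hj
    have h2 := h.simple_left j hj
    refine h.eq_simple_right _ (h.isPositiveRoot ha (hroot j) (Or.inr ?_)) ?_
    · rw [(hw _).2]; exact h2.1
    · rw [(hw _).1]; exact h2.2
  have h2 : ∀ j : Fin n, s ≤ (j : ℕ) → ∃ l : Fin n, (l : ℕ) < s ∧ -w (a j) = a l := by
    intro j hj
    have h2 := h.simple_right j hj
    refine h.eq_simple_left _ (h.isPositiveRoot ha (hroot j) (Or.inl ?_)) ?_
    · rw [(hw _).1]; exact h2.2
    · rw [(hw _).2]; exact h2.1
  choose f hf1 hf2 using h1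
  choose g hg1 hg2 using h2
  have c1 := Fintype.card_le_of_injective
    (fun i : Fin s => (⟨(f ⟨i, by omega⟩ i.2 : ℕ) - s, by omega⟩ : Fin (n - s))) (by
      intro i j hij
      have e : f ⟨i, by omega⟩ i.2 = f ⟨j, by omega⟩ j.2 := by
        have a1 := hf1 ⟨i, by omega⟩ i.2
        have a2 := hf1 ⟨j, by omega⟩ j.2
        have a3 := congrArg Fin.val hij
        simp only at a3
        exact Fin.ext (by omega)
      have e1 := hf2 ⟨i, by omega⟩ i.2
      rw [e] at e1
      have := congrArg Fin.val (hinj e1 (hf2 ⟨j, by omega⟩ j.2))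
      exact Fin.ext this)
  have c2 := Fintype.card_le_of_injective
    (fun i : Fin (n - s) => (⟨(g ⟨s + i, by omega⟩ (by simp) : ℕ), hg1 _ _⟩ : Fin s)) (by
      intro i j hij
      have e : g ⟨s + i, by omega⟩ (by simp) = g ⟨s + j, by omega⟩ (by simp) := by
        have a3 := congrArg Fin.val hij
        simp only at a3
        exact Fin.ext (by omega)
      have e1 := hg2 ⟨s + i, by omega⟩ (by simp)
      rw [e] at e1
      have := congrArg Fin.val (hinj e1 (hg2 ⟨s + j, by omega⟩ (by simp)))
      simp only at this
      exact Fin.ext (by omega))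
  simp only [Fintype.card_fin] at c1 c2
  omega

end IsCoxeterPlane

/-- The first half of Steinberg's theorem: the roots `ρ_k` in the first half of the Coxeter cycle
are positive, and the product of the corresponding reflections reverses the sign of all roots. -/
theorem IsSimpleSystem.steinberg (ha : IsSimpleSystem W a)
    (hW : IsFiniteIrreducibleReflectionGroup W) (hn : 2 ≤ n) {s : ℕ} (hs : IsBipartite a s) :
    (∀ k < numPos a, IsPositiveRoot W a (rho a k)) ∧
      ∀ v, IsPositiveRoot W a v → IsPositiveRoot W a (-prefixProd a (numPos a) v) := by
  obtain ⟨hs0, hsn⟩ := ha.block_sizes hW hn hs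
  obtain ⟨p, q, θ, h⟩ := ha.exists_isCoxeterPlane hW hn hs
  obtain ⟨m, hm, hmθ⟩ := h.exists_angle ha hs0 hsn
  have hord := h.orderOf_cox ha hs0 hm hmθ
  have hsin := h.sin_pos
  have hθ := h.theta_pos
  have hsinpos : ∀ b : ℕ, 0 < b → b < m → 0 < Real.sin (b * θ) := by
    intro b hb0 hbm
    have h1 : (0 : ℝ) < b := by exact_mod_cast hb0
    have h2 : (b : ℝ) < m := by exact_mod_cast hbm
    refine Real.sin_pos_of_pos_of_lt_pi (by positivity) ?_
    rw [← hmθ]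
    nlinarith
  have hleft : ∀ (k : ℕ) (j : Fin n), (j : ℕ) < s → 2 * k + 1 ≤ m →
      IsPositiveRoot W a (rho a (k * n + j)) := by
    intro k j hj hk
    obtain ⟨e1, e2⟩ := h.cox_pow k (a j)
    have hj' := h.simple_left j hj
    refine h.isPositiveRoot ha (ha.isRoot_rho _) ?_
    rw [ha.rho_left hs k j hj]
    -- For k = 0 the value of `q` is zero and `p` must decide; afterwards `q` is a positive multiple
    -- of sin 2kθ.
    rcases Nat.eq_zero_or_pos k with rfl | hk0
    · left
      rw [pow_zero]
      exact hj'.1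
    · right
      have h3 := hsinpos (2 * k) (by omega) (by omega)
      push_cast at h3
      rw [hj'.2, mul_zero, sub_zero] at e2
      have := mul_pos h3 hj'.1
      rw [← e2] at this
      exact (mul_pos_iff_of_pos_left hsin).1 this
  have hright : ∀ (k : ℕ) (j : Fin n), s ≤ (j : ℕ) → 2 * k + 2 ≤ m →
      IsPositiveRoot W a (rho a (k * n + j)) := by
    intro k j hj hk
    obtain ⟨e1, e2⟩ := h.cox_pow_prefix k (a j)
    have hj' := h.simple_right j hj
    refine h.isPositiveRoot ha (ha.isRoot_rho _) ?_
    rw [ha.rho_right hs k j hj]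
    right
    have h3 := hsinpos (2 * k + 1) (by omega) (by omega)
    rw [show ((2 * k + 1 : ℕ) : ℝ) * θ = 2 * k * θ + θ by push_cast; ring] at h3
    rw [hj'.1, mul_zero, sub_zero] at e2
    have := mul_pos h3 hj'.2
    rw [← e2] at this
    exact (mul_pos_iff_of_pos_left hsin).1 this
  have hdecomp : ∀ k : ℕ, k = k / n * n + ((⟨k % n, Nat.mod_lt _ (by omega)⟩ : Fin n) : ℕ) :=
    fun k => (Nat.div_add_mod' k n).symm
  have hmem := prefixProd_mem ha (numPos a)
  rcases Nat.even_or_odd' m with ⟨k, hk | hk⟩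
  · have hN : numPos a = k * n := by
      rw [numPos, hord, hk, show n * (2 * k) = 2 * (k * n) by ring]
      omega
    refine ⟨fun l hl => ?_, fun v hv => ?_⟩
    · have hlk : l / n < k := by
        rw [hN] at hl
        exact Nat.div_lt_of_lt_mul (by rwa [mul_comm] at hl)
      rw [hdecomp l]
      rcases lt_or_ge (l % n) s with h1 | h1
      · exact hleft _ _ h1 (by omega)
      · exact hright _ _ h1 (by omega)
    · have e : prefixProd a (numPos a) = cox a ^ k := by
        rw [hN, ← Nat.add_zero (k * n), prefixProd_mul_add]
        simp [prefixProd]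
      rw [e] at hmem ⊢
      have h1 := h.half_pow_even (by rw [← hk]; exact hmθ) v
      have h2 := h.add_pos v hv
      refine h.isPositiveRoot ha (hv.1.map hmem).neg ?_
      rw [map_neg, map_neg, h1.1, h1.2, neg_neg, neg_neg]
      by_contra! h4
      linarith [h4.1, h4.2]
  · have hmθ' : ((2 * k + 1 : ℕ) : ℝ) * θ = Real.pi := by rw [← hk]; exact hmθ
    have hns := h.two_mul_block_of_odd ha hsn hmθ'
    have hN : numPos a = k * n + s := by
      have : n * m = 2 * (k * n + s) := by rw [hk]; nlinarith
      rw [numPos, hord, this]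
      omega
    refine ⟨fun l hl => ?_, fun v hv => ?_⟩
    · rw [hN] at hl
      have hlk : l / n < k ∨ l / n = k ∧ l % n < s := by
        have h0 := Nat.div_add_mod' l n
        rcases lt_trichotomy (l / n) k with h1 | h1 | h1
        · exact Or.inl h1
        · right
          rw [h1] at h0
          exact ⟨h1, by omega⟩
        · have : (k + 1) * n ≤ l / n * n := Nat.mul_le_mul_right n h1
          rw [add_mul, one_mul] at this
          omega
      rw [hdecomp l]
      rcases lt_or_ge (l % n) s with h1 | h1
      · exact hleft _ _ h1 (by omega)
      · exact hright _ _ h1 (by omega)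
    · have e : prefixProd a (numPos a) v = (cox a ^ k) (prefixProd a s v) := by
        rw [hN, prefixProd_mul_add]
        rfl
      have h1 := h.half_pow_odd hmθ' v
      have h2 := h.add_pos v hv
      refine h.isPositiveRoot ha (hv.1.map hmem).neg ?_
      rw [e, map_neg, map_neg, h1.1, h1.2, neg_neg, neg_neg]
      by_contra! h4
      linarith [h4.1, h4.2]

end

/-! ### Enumeration of the positive roots and the operator 2(1 - γ)⁻¹ -/

section

variable {n : ℕ} [NeZero n] {W : Subgroup (Orth n)} {a : Fin n → Euc n}

theorem prefixProd_inv_succ_apply (k : ℕ) (v : Euc n) :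
    (prefixProd a (k + 1))⁻¹ v = refl (a (Fin.ofNat n k)) ((prefixProd a k)⁻¹ v) := by
  have : (prefixProd a (k + 1))⁻¹ = refl (a (Fin.ofNat n k)) * (prefixProd a k)⁻¹ := by
    rw [← refl_inv (a _), ← mul_inv_rev]
    rfl
  rw [this]
  rfl

theorem prefixProd_inv_rho (k : ℕ) : (prefixProd a k)⁻¹ (rho a k) = a (Fin.ofNat n k) :=
  inv_apply_self _ _

theorem eq_rho_of_inv_eq {k : ℕ} {v : Euc n} (h : (prefixProd a k)⁻¹ v = a (Fin.ofNat n k)) :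
    v = rho a k := by
  rw [rho, ← h, apply_inv_self]

/-- The second half of Steinberg's theorem: every positive root is one of the `ρ_k`. -/
theorem IsSimpleSystem.exists_eq_rho (ha : IsSimpleSystem W a)
    (hneg : ∀ v, IsPositiveRoot W a v → IsPositiveRoot W a (-prefixProd a (numPos a) v))
    {v : Euc n} (hv : IsPositiveRoot W a v) : ∃ k < numPos a, v = rho a k := by
  by_contra! hcon
  -- Stripping one simple reflection at a time, the root can change sign only where it equals the
  -- next simple root, that is, where it is a ρ_k. Without a sign change it contradicts `hneg`.
  have h1 : ∀ k ≤ numPos a, IsPositiveRoot W a ((prefixProd a k)⁻¹ v) := by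
    intro k
    induction k with
    | zero => intro _; simpa [prefixProd] using hv
    | succ k ih =>
      intro hk
      by_contra h'
      rw [prefixProd_inv_succ_apply] at h'
      exact hcon k (by omega) (eq_rho_of_inv_eq (ha.eq_simple (ih (by omega)) h'))
  have h2 := hneg _ (h1 _ le_rfl)
  rw [apply_inv_self] at h2
  exact ha.not_pos_and_neg hv h2

/-- Descending from index `j`, where the root is simple, a sign change at step `k` would force -ρ_j
= ρ_k, impossible for two positive roots. The next lemma ascends from `i + 1` in the same way. -/
theorem IsSimpleSystem.isPositiveRoot_inv_rho (ha : IsSimpleSystem W a)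
    (hpos : ∀ k < numPos a, IsPositiveRoot W a (rho a k)) {i j : ℕ} (hij : i ≤ j)
    (hj : j < numPos a) : IsPositiveRoot W a ((prefixProd a i)⁻¹ (rho a j)) := by
  induction hij using Nat.decreasingInduction with
  | self => rw [prefixProd_inv_rho]; exact ha.isPositiveRoot_simple _
  | of_succ k hk ih =>
    by_contra h'
    have e : (prefixProd a k)⁻¹ (rho a j) =
        refl (a (Fin.ofNat n k)) ((prefixProd a (k + 1))⁻¹ (rho a j)) := by
      rw [prefixProd_inv_succ_apply, refl_refl]
    rw [e] at h'
    have h1 := ha.eq_simple ih h'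
    rw [h1, refl_self (ha.isRoot _).1] at e
    have h2 : -rho a j = rho a k := eq_rho_of_inv_eq (by rw [map_neg, e, neg_neg])
    refine ha.not_pos_and_neg (hpos j hj) ?_
    rw [h2]
    exact hpos k (by omega)

theorem IsSimpleSystem.isPositiveRoot_neg_inv_rho (ha : IsSimpleSystem W a)
    (hpos : ∀ k < numPos a, IsPositiveRoot W a (rho a k)) {i j : ℕ} (hij : i < j)
    (hj : j ≤ numPos a) : IsPositiveRoot W a (-(prefixProd a j)⁻¹ (rho a i)) := by
  induction j, hij using Nat.le_induction with
  | base =>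
    rw [prefixProd_inv_succ_apply, prefixProd_inv_rho, refl_self (ha.isRoot _).1, neg_neg]
    exact ha.isPositiveRoot_simple _
  | succ k hk ih =>
    by_contra h'
    rw [prefixProd_inv_succ_apply, ← map_neg] at h'
    have h1 := ha.eq_simple (ih (by omega)) h'
    have h2 : -rho a i = rho a k := eq_rho_of_inv_eq (by rw [map_neg, h1])
    refine ha.not_pos_and_neg (hpos i (by omega)) ?_
    rw [h2]
    exact hpos k (by omega)

theorem IsSimpleSystem.rho_injOn (ha : IsSimpleSystem W a)
    (hpos : ∀ k < numPos a, IsPositiveRoot W a (rho a k)) {i j : ℕ} (hi : i < numPos a)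
    (hj : j < numPos a) (h : rho a i = rho a j) : i = j := by
  have key : ∀ {i j : ℕ}, i < j → j < numPos a → rho a i ≠ rho a j := by
    intro i j hij hj h
    have h1 := ha.isPositiveRoot_neg_inv_rho hpos (Nat.lt_succ_self i) (by omega)
    have h2 := ha.isPositiveRoot_inv_rho hpos (show i + 1 ≤ j from hij) hj
    rw [← h] at h2
    exact ha.not_pos_and_neg h2 h1
  rcases lt_trichotomy i j with h1 | h1 | h1
  · exact absurd h (key h1 hj)
  · exact h1
  · exact absurd h.symm (key h1 hi)

/-- One more turn of γ applies n further simple reflections. The weight is fixed by all of them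
except R(a_k), which subtracts 2a_k. Hence 2(1 - γ)⁻¹ρ_k is the transported weight. -/
theorem prefixProd_weight (ha : IsSimpleSystem W a) (k : ℕ) :
    cox a (prefixProd a k (ha.weight (Fin.ofNat n k))) =
      prefixProd a k (ha.weight (Fin.ofNat n k)) - (2 : ℝ) • rho a k := by
  have hin : ∀ l, inner ℝ (a (Fin.ofNat n l)) (ha.weight (Fin.ofNat n k)) =
      ha.coord (Fin.ofNat n k) (a (Fin.ofNat n l)) := fun l => by
    rw [real_inner_comm, ha.inner_weight]
  have h1 : cox a (prefixProd a k (ha.weight (Fin.ofNat n k))) =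
      prefixProd a (n + k) (ha.weight (Fin.ofNat n k)) := by
    rw [prefixProd_period]; rfl
  have hn : 0 < n := Nat.pos_of_ne_zero (NeZero.ne n)
  rw [h1, show n + k = (k + 1) + (n - 1) by omega, ha.prefixProd_add_of_inner_eq_zero]
  · rw [prefixProd_succ_apply, refl_apply (ha.isRoot _).1, hin, ha.coord_self, map_sub, map_smul,
      mul_one]
    rfl
  · intro l h1 h2
    rw [hin, ha.coord_of_ne]
    intro h
    have h3 : k % n = l % n := by simpa [Fin.ext_iff] using h
    have h4 : (l - k) % n = 0 := Nat.sub_mod_eq_zero_of_mod_eq h3.symm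
    rw [Nat.mod_eq_of_lt (by omega)] at h4
    omega

/-- The Coxeter element has no nonzero fixed vector. -/
theorem IsSimpleSystem.eq_zero_of_cox_fixed (ha : IsSimpleSystem W a)
    (hneg : ∀ v, IsPositiveRoot W a v → IsPositiveRoot W a (-prefixProd a (numPos a) v))
    {x : Euc n} (hx : cox a x = x) : x = 0 := by
  -- Since γ is an isometry fixing `x`, pairing with a transported weight leaves only the term -2⟨x,
  -- ρ_k⟩, which must vanish.
  have h1 : ∀ k, inner ℝ x (rho a k) = 0 := by
    intro k
    set y := prefixProd a k (ha.weight (Fin.ofNat n k)) with hy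
    have h2 := (cox a).inner_map_map x y
    rw [hx, prefixProd_weight, inner_sub_right, inner_smul_right] at h2
    linarith
  rw [← inner_self_eq_zero (𝕜 := ℝ)]
  conv_lhs => arg 2; rw [← ha.sum_coord x]
  rw [sum_inner]
  refine Finset.sum_eq_zero fun i _ => ?_
  obtain ⟨k, -, hk⟩ := ha.exists_eq_rho hneg (ha.isPositiveRoot_simple i)
  rw [inner_smul_left, real_inner_comm, hk, h1, mul_zero]

/-- The operator `2 (1 - γ)⁻¹` for the Coxeter element `γ`. -/
theorem IsSimpleSystem.exists_inverse (ha : IsSimpleSystem W a)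
    (hneg : ∀ v, IsPositiveRoot W a v → IsPositiveRoot W a (-prefixProd a (numPos a) v)) :
    ∃ μ : Euc n →ₗ[ℝ] Euc n, (∀ x, cox a (μ x) = μ x - (2 : ℝ) • x) ∧
      ∀ x y, cox a y = y - (2 : ℝ) • x → μ x = y := by
  let f : Euc n →ₗ[ℝ] Euc n := LinearMap.id - (cox a).toLinearEquiv.toLinearMap
  have hf : ∀ x, f x = x - cox a x := fun x => rfl
  have hinj : Function.Injective f := by
    rw [← LinearMap.ker_eq_bot, LinearMap.ker_eq_bot']
    intro x hx
    rw [hf, sub_eq_zero] at hx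
    exact ha.eq_zero_of_cox_fixed hneg hx.symm
  let e := LinearEquiv.ofInjectiveEndo f hinj
  have he : ∀ x, f (e.symm x) = x := fun x => e.apply_symm_apply x
  have hμ : ∀ x, f ((2 : ℝ) • e.symm x) = (2 : ℝ) • x := fun x => by rw [map_smul, he]
  refine ⟨(2 : ℝ) • e.symm.toLinearMap, fun x => ?_, fun x y hy => hinj ?_⟩
  · have := hμ x
    rw [hf] at this
    change cox a ((2 : ℝ) • e.symm x) = (2 : ℝ) • e.symm x - (2 : ℝ) • x
    rw [← this]
    abel
  · change f ((2 : ℝ) • e.symm x) = f y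
    rw [hμ, hf, hy]
    abel

/-- A nonzero vector orthogonal to fewer than `n` given vectors of `ℝⁿ`. -/
theorem exists_ne_zero_orthogonal {n : ℕ} (L : List (Euc n)) (hL : L.length < n) :
    ∃ x : Euc n, x ≠ 0 ∧ ∀ v ∈ L, inner ℝ v x = 0 := by
  classical
  have h1 : Module.finrank ℝ (Submodule.span ℝ (L.toFinset : Set (Euc n))) < n :=
    (finrank_span_finset_le_card L.toFinset).trans_lt (L.toFinset_card_le.trans_lt hL)
  have h2 : Submodule.span ℝ (L.toFinset : Set (Euc n)) ≠ ⊤ := by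
    intro h
    rw [h, finrank_top, finrank_euclideanSpace_fin] at h1
    exact lt_irrefl _ h1
  obtain ⟨x, hx, hx0⟩ := Submodule.exists_mem_ne_zero_of_ne_bot
    (mt (Submodule.orthogonal_eq_bot_iff).1 h2)
  exact ⟨x, hx0, fun v hv => (Submodule.mem_orthogonal _ _).1 hx v
    (Submodule.subset_span (by simpa using hv))⟩

end

/-! ### Reflection length and the order it defines -/

section

section Length

variable {n : ℕ} {W : Subgroup (Orth n)} {a : Fin n → Euc n}

theorem refl_mem_reflections {v : Euc n} (hv : IsRoot W v) : refl v ∈ reflections W := ⟨v, hv, rfl⟩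

theorem len_le_of_prod {L : List (Orth n)} (hL : ∀ r ∈ L, r ∈ reflections W) :
    len W L.prod ≤ L.length :=
  Nat.sInf_le ⟨L, hL, rfl, rfl⟩

/-- The infimum defining `len` is attained: reflections generate `W` and are their own inverses, so
the set is nonempty and the default value `sInf ∅ = 0` never intervenes. -/
theorem IsFiniteIrreducibleReflectionGroup.exists_list (hW : IsFiniteIrreducibleReflectionGroup W)
    {w : Orth n} (hw : w ∈ W) :
    ∃ L : List (Orth n), (∀ r ∈ L, r ∈ reflections W) ∧ L.prod = w ∧ L.length = len W w := by
  refine Nat.sInf_mem (s := {k | ∃ L : List (Orth n), (∀ r ∈ L, r ∈ reflections W) ∧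
    L.prod = w ∧ L.length = k}) ?_
  rw [← hW.generated] at hw
  rw [← Subgroup.mem_toSubmonoid, Subgroup.closure_toSubmonoid] at hw
  obtain ⟨L, hL, hprod⟩ := Submonoid.exists_list_of_mem_closure hw
  refine ⟨L.length, L, fun r hr => ?_, hprod, rfl⟩
  rcases hL r hr with h | ⟨v, hv, h⟩
  · exact h
  · rw [← refl_inv, inv_inj] at h
    exact ⟨v, hv, h⟩

theorem det_refl {v : Euc n} (hv : ‖v‖ = 1) :
    LinearMap.det ((refl v).toLinearEquiv : Euc n →ₗ[ℝ] Euc n) = -1 := by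
  have h0 : v ≠ 0 := by rintro rfl; simp at hv
  have h := Submodule.det_reflection ((Submodule.span ℝ {v})ᗮ)
  rw [Submodule.orthogonal_orthogonal, finrank_span_singleton h0, pow_one] at h
  exact h

theorem det_mul_orth (g h : Orth n) :
    LinearMap.det ((g * h).toLinearEquiv : Euc n →ₗ[ℝ] Euc n) =
      LinearMap.det (g.toLinearEquiv : Euc n →ₗ[ℝ] Euc n) *
      LinearMap.det (h.toLinearEquiv : Euc n →ₗ[ℝ] Euc n) := by
  rw [← LinearMap.det_comp]
  rfl

namespace IsFiniteIrreducibleReflectionGroup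

theorem eq_one_of_len (hW : IsFiniteIrreducibleReflectionGroup W) {w : Orth n} (hw : w ∈ W)
    (h : len W w = 0) : w = 1 := by
  obtain ⟨L, -, rfl, hl⟩ := hW.exists_list hw
  rw [h, List.length_eq_zero_iff] at hl
  rw [hl, List.prod_nil]

theorem exists_refl_of_len (hW : IsFiniteIrreducibleReflectionGroup W) {w : Orth n} (hw : w ∈ W)
    (h : len W w = 1) : ∃ v, IsRoot W v ∧ w = refl v := by
  obtain ⟨L, hL, rfl, hl⟩ := hW.exists_list hw
  rw [h, List.length_eq_one_iff] at hl
  obtain ⟨r, rfl⟩ := hl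
  obtain ⟨v, hv, rfl⟩ := hL r (by simp)
  exact ⟨v, hv, by simp⟩

theorem exists_refl_mul_of_len (hW : IsFiniteIrreducibleReflectionGroup W) {w : Orth n}
    (hw : w ∈ W) (h : len W w = 2) : ∃ u v, IsRoot W u ∧ IsRoot W v ∧ w = refl u * refl v := by
  obtain ⟨L, hL, rfl, hl⟩ := hW.exists_list hw
  rw [h, List.length_eq_two] at hl
  obtain ⟨r, r', rfl⟩ := hl
  obtain ⟨u, hu, rfl⟩ := hL r (by simp)
  obtain ⟨v, hv, rfl⟩ := hL r' (by simp)
  exact ⟨u, v, hu, hv, by simp⟩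

theorem len_refl (hW : IsFiniteIrreducibleReflectionGroup W) {v : Euc n} (hv : IsRoot W v) :
    len W (refl v) = 1 := by
  have h1 : len W (refl v) ≤ 1 := by
    simpa using len_le_of_prod (W := W) (L := [refl v])
      (by simpa using refl_mem_reflections hv)
  have h2 : len W (refl v) ≠ 0 := by
    intro h
    have h3 := hW.eq_one_of_len hv.2 h
    have h4 := refl_self hv.1
    rw [h3] at h4
    change v = -v at h4
    refine hv.ne_zero ?_
    linear_combination (norm := module) (1 / 2 : ℝ) • h4
  omega

/-- Length one is excluded by the determinant. -/
theorem len_refl_mul (hW : IsFiniteIrreducibleReflectionGroup W) {u v : Euc n} (hu : IsRoot W u)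
    (hv : IsRoot W v) (hne : refl u ≠ refl v) : len W (refl u * refl v) = 2 := by
  have hmem : refl u * refl v ∈ W := W.mul_mem hu.2 hv.2
  have h1 : len W (refl u * refl v) ≤ 2 := by
    simpa using len_le_of_prod (W := W) (L := [refl u, refl v])
      (by simpa using ⟨refl_mem_reflections hu, refl_mem_reflections hv⟩)
  have h2 : len W (refl u * refl v) ≠ 0 := by
    intro h
    have h3 := hW.eq_one_of_len hmem h
    rw [mul_eq_one_iff_eq_inv, refl_inv] at h3
    exact hne h3
  have h3 : len W (refl u * refl v) ≠ 1 := by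
    intro h
    obtain ⟨x, hx, h3⟩ := hW.exists_refl_of_len hmem h
    have h4 := det_mul_orth (refl u) (refl v)
    rw [h3, det_refl hx.1, det_refl hu.1, det_refl hv.1] at h4
    norm_num at h4
  omega

end IsFiniteIrreducibleReflectionGroup

theorem conj_mem_reflections {g r : Orth n} (hg : g ∈ W) (hr : r ∈ reflections W) :
    g * r * g⁻¹ ∈ reflections W := by
  obtain ⟨v, hv, rfl⟩ := hr
  exact ⟨g v, hv.map hg, (refl_map g hv.1).symm⟩

theorem len_conj_le (hW : IsFiniteIrreducibleReflectionGroup W) {g w : Orth n} (hg : g ∈ W)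
    (hw : w ∈ W) : len W (g * w * g⁻¹) ≤ len W w := by
  obtain ⟨L, hL, rfl, hl⟩ := hW.exists_list hw
  have h := len_le_of_prod (W := W) (L := L.map (MulAut.conj g)) (by
    intro r hr
    obtain ⟨r', hr', rfl⟩ := List.mem_map.1 hr
    exact conj_mem_reflections hg (hL r' hr'))
  rw [List.length_map, hl, ← map_list_prod] at h
  exact h

theorem len_conj (hW : IsFiniteIrreducibleReflectionGroup W) {g w : Orth n} (hg : g ∈ W)
    (hw : w ∈ W) : len W (g * w * g⁻¹) = len W w := by
  refine le_antisymm (len_conj_le hW hg hw) ?_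
  have h := len_conj_le hW (W.inv_mem hg) (W.mul_mem (W.mul_mem hg hw) (W.inv_mem hg))
  simpa [mul_assoc] using h

theorem len_inv_le (hW : IsFiniteIrreducibleReflectionGroup W) {w : Orth n}
    (hw : w ∈ W) : len W w⁻¹ ≤ len W w := by
  obtain ⟨L, hL, rfl, hl⟩ := hW.exists_list hw
  have h := len_le_of_prod (W := W) (L := (L.map fun r => r⁻¹).reverse) (by
    intro r hr
    rw [List.mem_reverse] at hr
    obtain ⟨r', hr', rfl⟩ := List.mem_map.1 hr
    obtain ⟨v, hv, rfl⟩ := hL r' hr'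
    rw [refl_inv]
    exact refl_mem_reflections hv)
  rw [List.length_reverse, List.length_map, hl, ← List.prod_inv_reverse] at h
  exact h

theorem len_inv (hW : IsFiniteIrreducibleReflectionGroup W) {w : Orth n}
    (hw : w ∈ W) : len W w⁻¹ = len W w := by
  refine le_antisymm (len_inv_le hW hw) ?_
  have h := len_inv_le hW (W.inv_mem hw)
  rwa [inv_inv] at h

/-- Length is invariant under inversion and conjugation. This carries the edge condition, stated for
γ⁻¹, over to γ. -/
theorem Precedes.inv (hW : IsFiniteIrreducibleReflectionGroup W) {u w : Orth n}
    (h : Precedes W u w) : Precedes W u⁻¹ w⁻¹ := by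
  obtain ⟨hu, hw, hl⟩ := h
  refine ⟨W.inv_mem hu, W.inv_mem hw, ?_⟩
  rw [len_inv hW hu, len_inv hW hw, hl, inv_inv]
  have h1 : u * w⁻¹ = (u * (u⁻¹ * w) * u⁻¹)⁻¹ := by group
  have hm := W.mul_mem (W.inv_mem hu) hw
  rw [h1, len_inv hW (W.mul_mem (W.mul_mem hu hm) (W.inv_mem hu)), len_conj hW hu hm]

/-- The positive roots below a product `σ` of two reflections are those which occur as the first
factor in a factorization of `σ`. -/
theorem mem_rootsBelow_iff (hW : IsFiniteIrreducibleReflectionGroup W) (ha : IsSimpleSystem W a)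
    {σ : Orth n} (hσ : σ ∈ W) (hlen : len W σ = 2) (u : Euc n) :
    u ∈ rootsBelow W a σ ↔
      IsPositiveRoot W a u ∧ ∃ v, IsPositiveRoot W a v ∧ σ = refl u * refl v := by
  constructor
  · rintro ⟨hu, -, -, h⟩
    refine ⟨hu, ?_⟩
    rw [hlen, hW.len_refl hu.1, refl_inv] at h
    obtain ⟨v, hv, h1⟩ := hW.exists_refl_of_len (W.mul_mem hu.1.2 hσ) (by omega)
    have h2 : σ = refl u * refl v := by
      rw [← h1, ← mul_assoc, refl_mul_self, one_mul]
    rcases ha.pos_or_neg hv with h3 | h3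
    · exact ⟨v, h3, h2⟩
    · exact ⟨-v, h3, by rw [refl_neg]; exact h2⟩
  · rintro ⟨hu, v, hv, h⟩
    refine ⟨hu, hu.1.2, hσ, ?_⟩
    rw [hlen, hW.len_refl hu.1, h, inv_mul_cancel_left, hW.len_refl hv.1]

/-- The second factor of a factorization into two reflections also occurs as a first factor. -/
theorem mem_rootsBelow_right (hW : IsFiniteIrreducibleReflectionGroup W)
    (ha : IsSimpleSystem W a) {u v : Euc n} (hu : IsPositiveRoot W a u)
    (hv : IsPositiveRoot W a v) (hlen : len W (refl u * refl v) = 2) :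
    v ∈ rootsBelow W a (refl u * refl v) := by
  rw [mem_rootsBelow_iff hW ha (W.mul_mem hu.1.2 hv.1.2) hlen]
  refine ⟨hv, ?_⟩
  -- Hurwitz move.
  have h1 : refl u * refl v = refl v * refl (refl v u) := by
    rw [refl_map _ hu.1.1, refl_inv, ← mul_assoc, ← mul_assoc, refl_mul_self, one_mul]
  rcases ha.pos_or_neg (hu.1.map hv.1.2) with h | h
  · exact ⟨_, h, h1⟩
  · exact ⟨_, h, by rw [refl_neg]; exact h1⟩

end Length

variable {n : ℕ} [NeZero n] {W : Subgroup (Orth n)} {a : Fin n → Euc n}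

theorem IsSimpleSystem.len_cox_le (ha : IsSimpleSystem W a) : len W (cox a) ≤ n := by
  have h := len_le_of_prod (W := W)
    (L := ((List.range n).map (Fin.ofNat n)).map fun i => refl (a i)) (by
      intro r hr
      obtain ⟨i, -, rfl⟩ := List.mem_map.1 hr
      exact refl_mem_reflections (ha.isRoot i))
  rw [← prefixProd_eq_list_prod, List.length_map, List.length_map, List.length_range] at h
  exact h

/-- If `R(u) R(v)` precedes the Coxeter element, then `(1 - γ)⁻¹ u` is orthogonal to `v`. -/
theorem inner_eq_zero_of_precedes (hW : IsFiniteIrreducibleReflectionGroup W)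
    (ha : IsSimpleSystem W a)
    (hneg : ∀ v, IsPositiveRoot W a v → IsPositiveRoot W a (-prefixProd a (numPos a) v))
    {μ : Euc n →ₗ[ℝ] Euc n} (hμ : ∀ x y, cox a y = y - (2 : ℝ) • x → μ x = y) {u v : Euc n}
    (hu : IsRoot W u) (hv : IsRoot W v) (hne : refl u ≠ refl v)
    (h : Precedes W (refl u * refl v) (cox a)) : inner ℝ (μ u) v = 0 := by
  obtain ⟨h1, h2, h3⟩ := h
  rw [hW.len_refl_mul hu hv hne] at h3
  have hle := ha.len_cox_le
  obtain ⟨L, hL, hprod, hl⟩ := hW.exists_list (W.mul_mem (W.inv_mem h1) h2)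
  have hvec : ∀ L : List (Orth n), (∀ r ∈ L, r ∈ reflections W) →
      ∃ V : List (Euc n), V.length = L.length ∧
        ∀ x, (∀ v ∈ V, inner ℝ v x = 0) → L.prod x = x := by
    intro L
    induction L with
    | nil => exact fun _ => ⟨[], rfl, fun x _ => rfl⟩
    | cons r L ih =>
      intro h
      obtain ⟨V, hV1, hV2⟩ := ih fun r hr => h r (List.mem_cons_of_mem _ hr)
      obtain ⟨v, hv, rfl⟩ := h r List.mem_cons_self
      refine ⟨v :: V, by simp [hV1], fun x hx => ?_⟩
      rw [List.prod_cons]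
      change refl v (L.prod x) = x
      rw [hV2 x fun v hv => hx v (List.mem_cons_of_mem _ hv)]
      exact refl_of_inner_eq_zero hv.1 (hx v List.mem_cons_self)
  obtain ⟨V, hV1, hV2⟩ := hvec L hL
  -- The rest of γ has length at most n - 2, so together with `v` there are at most n - 1
  -- orthogonality conditions.
  obtain ⟨x, hx0, hx⟩ := exists_ne_zero_orthogonal (v :: V) (by
    rw [List.length_cons, hV1, hl]
    omega)
  have hwx := hV2 x fun v hv => hx v (List.mem_cons_of_mem _ hv)
  have hvx := hx v List.mem_cons_self
  rw [hprod] at hwx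
  -- Only R(u) moves `x`, so μ(⟨u, x⟩u) = x, which is orthogonal to `v`. The scalar is nonzero
  -- because γ has no nonzero fixed vector.
  have hγ : cox a x = x - (2 : ℝ) • (inner ℝ u x • u) := by
    have e : cox a = (refl u * refl v) * ((refl u * refl v)⁻¹ * cox a) := by group
    have e2 : cox a x = (refl u * refl v) (((refl u * refl v)⁻¹ * cox a) x) := by
      conv_lhs => rw [e]
      rfl
    rw [e2, hwx]
    change refl u (refl v x) = _
    rw [refl_of_inner_eq_zero hv.1 hvx, refl_apply hu.1, smul_smul]
  have h4 := hμ _ _ hγ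
  have hux : inner ℝ u x ≠ 0 := by
    intro h0
    rw [h0, zero_smul, smul_zero, sub_zero] at hγ
    exact hx0 (ha.eq_zero_of_cox_fixed hneg hγ)
  rw [map_smul] at h4
  rw [← h4, real_inner_comm, inner_smul_left, mul_eq_zero] at hvx
  exact hvx.resolve_left (by simpa using hux)

end

/-! ### The form ⟨μx, y⟩ and the roots below an element of length two -/

section

variable {n : ℕ} [NeZero n] {W : Subgroup (Orth n)} {a : Fin n → Euc n}

/-- Expand |γ(μx)|² = |μx|². -/
theorem inner_self_of_cox {μ : Euc n →ₗ[ℝ] Euc n} (hμ : ∀ x, cox a (μ x) = μ x - (2 : ℝ) • x)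
    (x : Euc n) : inner ℝ (μ x) x = inner ℝ x x := by
  have h := (cox a).inner_map_map (μ x) (μ x)
  rw [hμ, inner_sub_left, inner_sub_right, inner_sub_right, inner_smul_left, inner_smul_left,
    inner_smul_right, inner_smul_right, real_inner_comm (μ x) x] at h
  simp only [conj_trivial] at h
  linarith

theorem IsSimpleSystem.inner_rho_eq_coord (ha : IsSimpleSystem W a) {μ : Euc n →ₗ[ℝ] Euc n}
    (hμ : ∀ x y, cox a y = y - (2 : ℝ) • x → μ x = y) (k : ℕ) (v : Euc n) :
    inner ℝ (μ (rho a k)) v = ha.coord (Fin.ofNat n k) ((prefixProd a k)⁻¹ v) := by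
  rw [hμ _ _ (prefixProd_weight ha k), ← ha.inner_weight, real_inner_comm, ← inner_inv_apply,
    real_inner_comm]

/-- The data needed about the positive roots of `W`: Steinberg's enumeration `ρ_0, ρ_1, …`, and the
operator `μ = 2 (1 - γ)⁻¹` with its sign pattern on this enumeration. -/
structure IsSteinbergForm (W : Subgroup (Orth n)) (a : Fin n → Euc n)
    (μ : Euc n →ₗ[ℝ] Euc n) : Prop where
  isPositiveRoot : ∀ k < numPos a, IsPositiveRoot W a (rho a k)
  exists_eq_rho : ∀ v, IsPositiveRoot W a v → ∃ k < numPos a, v = rho a k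
  injOn : ∀ {i j : ℕ}, i < numPos a → j < numPos a → rho a i = rho a j → i = j
  inner_self : ∀ x, inner ℝ (μ x) x = inner ℝ x x
  nonneg : ∀ {i j : ℕ}, i ≤ j → j < numPos a → 0 ≤ inner ℝ (μ (rho a i)) (rho a j)
  nonpos : ∀ {i j : ℕ}, i < j → j < numPos a → inner ℝ (μ (rho a j)) (rho a i) ≤ 0
  eq_zero : ∀ {u v : Euc n}, IsRoot W u → IsRoot W v → refl u ≠ refl v →
    Precedes W (refl u * refl v) (cox a) → inner ℝ (μ u) v = 0

theorem IsSimpleSystem.exists_isSteinbergForm (ha : IsSimpleSystem W a)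
    (hW : IsFiniteIrreducibleReflectionGroup W) (hn : 2 ≤ n) {s : ℕ} (hs : IsBipartite a s) :
    ∃ μ, IsSteinbergForm W a μ := by
  obtain ⟨hpos, hneg⟩ := ha.steinberg hW hn hs
  obtain ⟨μ, hμ1, hμ2⟩ := ha.exists_inverse hneg
  refine ⟨μ, hpos, fun v hv => ha.exists_eq_rho hneg hv, fun hi hj h => ha.rho_injOn hpos hi hj h,
    inner_self_of_cox hμ1, fun {i j} hij hj => ?_, fun {i j} hij hj => ?_,
    fun hu hv hne h => inner_eq_zero_of_precedes hW ha hneg hμ2 hu hv hne h⟩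
  · rw [ha.inner_rho_eq_coord hμ2]
    exact (ha.isNonnegComb_iff _).1 (ha.isPositiveRoot_inv_rho hpos hij hj).2 _
  · rw [ha.inner_rho_eq_coord hμ2]
    have h := (ha.isNonnegComb_iff _).1 (ha.isPositiveRoot_neg_inv_rho hpos hij hj.le).2
      (Fin.ofNat n j)
    rw [map_neg] at h
    linarith

theorem IsSteinbergForm.inner_self_root {μ : Euc n →ₗ[ℝ] Euc n} (h : IsSteinbergForm W a μ)
    {v : Euc n} (hv : IsRoot W v) : inner ℝ (μ v) v = 1 := by
  rw [h.inner_self, real_inner_self_eq_norm_sq, hv.1]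
  norm_num

/-- Let `ρ_i, ρ_j` be orthogonal for the form `⟨μ ·, ·⟩`. In the cyclic order of the enumeration no
positive root in their plane lies between `ρ_j` and `ρ_i`. -/
theorem IsSteinbergForm.not_between {μ : Euc n →ₗ[ℝ] Euc n} (h : IsSteinbergForm W a μ)
    (ha : IsSimpleSystem W a) {i j l : ℕ} (hi : i < numPos a) (hj : j < numPos a)
    (hl : l < numPos a) (h0 : inner ℝ (μ (rho a i)) (rho a j) = 0)
    (hspan : rho a l ∈ Submodule.span ℝ {rho a i, rho a j}) :
    ¬ ((j < l ∧ l < i) ∨ (l < i ∧ i < j) ∨ (i < j ∧ j < l)) := by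
  intro hcyc
  obtain ⟨x, y, hxy⟩ := Submodule.mem_span_pair.1 hspan
  have hi' := h.isPositiveRoot i hi
  have hj' := h.isPositiveRoot j hj
  have hl' := h.isPositiveRoot l hl
  have hii := h.inner_self_root hi'.1
  have hjj := h.inner_self_root hj'.1
  have hx0 : x ≠ 0 := by
    rintro rfl
    have := h.injOn hl hj (ha.eq_of_smul hl' hj' (c := y) (by rw [← hxy]; simp))
    omega
  have hy0 : y ≠ 0 := by
    rintro rfl
    have := h.injOn hl hi (ha.eq_of_smul hl' hi' (c := x) (by rw [← hxy]; simp))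
    omega
  have e1 : inner ℝ (μ (rho a i)) (rho a l) = x := by
    rw [← hxy, inner_add_right, inner_smul_right, inner_smul_right, hii, h0]; ring
  have e2 : inner ℝ (μ (rho a l)) (rho a j) = y := by
    rw [← hxy, map_add, map_smul, map_smul, inner_add_left, inner_smul_left, inner_smul_left,
      hjj, h0]
    simp
  have e3 : inner ℝ (μ (rho a j)) (rho a l) = x * inner ℝ (μ (rho a j)) (rho a i) + y := by
    rw [← hxy, inner_add_right, inner_smul_right, inner_smul_right, hjj]; ring
  have e4 : inner ℝ (μ (rho a l)) (rho a i) = x + y * inner ℝ (μ (rho a j)) (rho a i) := by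
    rw [← hxy, map_add, map_smul, map_smul, inner_add_left, inner_smul_left, inner_smul_left,
      hii]
    simp
  -- With b = ⟨μρ_j, ρ_i⟩, the sign pattern fixes the signs of x, y, b and of xb + y (or x + yb). In
  -- each cyclic position the two summands of that last quantity share a sign opposite to its own,
  -- so `y` (or `x`) vanishes.
  rcases hcyc with ⟨h1, h2⟩ | ⟨h1, h2⟩ | ⟨h1, h2⟩
  · have s1 := h.nonneg (h1.trans h2).le hi
    have s2 := h.nonpos h2 hi
    have s3 := h.nonpos h1 hl
    have s4 := h.nonneg h1.le hl
    rw [e1] at s2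
    rw [e2] at s3
    rw [e3] at s4
    have := mul_nonpos_of_nonpos_of_nonneg s2 s1
    exact hy0 (by linarith)
  · have s1 := h.nonpos h2 hj
    have s2 := h.nonpos h1 hi
    have s3 := h.nonneg (h1.trans h2).le hj
    have s4 := h.nonpos (h1.trans h2) hj
    rw [e1] at s2
    rw [e2] at s3
    rw [e3] at s4
    have := mul_nonneg_of_nonpos_of_nonpos s2 s1
    exact hy0 (by linarith)
  · have s1 := h.nonpos h1 hj
    have s2 := h.nonneg (h1.trans h2).le hl
    have s3 := h.nonpos h2 hl
    have s4 := h.nonpos (h1.trans h2) hl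
    rw [e1] at s2
    rw [e2] at s3
    rw [e4] at s4
    have := mul_nonneg_of_nonpos_of_nonpos s3 s1
    exact hx0 (by linarith)

/-- Reflections occurring in factorizations of the same plane rotation have coplanar normals. -/
theorem mem_span_of_refl_mul_eq {n : ℕ} {u v w w' : Euc n} (hu : ‖u‖ = 1) (hv : ‖v‖ = 1)
    (hw : ‖w‖ = 1) (hw' : ‖w'‖ = 1) (hne : refl w ≠ refl w')
    (h : refl u * refl v = refl w * refl w') : w ∈ Submodule.span ℝ {u, v} := by
  rw [← Submodule.orthogonal_orthogonal (Submodule.span ℝ {u, v}), Submodule.mem_orthogonal']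
  intro x hx
  rw [Submodule.mem_orthogonal] at hx
  have hux := hx u (Submodule.subset_span (by simp))
  have hvx := hx v (Submodule.subset_span (by simp))
  have h1 : (refl w * refl w') x = x := by
    rw [← h]
    change refl u (refl v x) = x
    rw [refl_of_inner_eq_zero hv hvx, refl_of_inner_eq_zero hu hux]
  -- Hence ⟨w, x⟩w = ⟨w', x⟩w'; a nonzero coefficient ⟨w, x⟩ would make the two reflections equal.
  have h2 : refl w' x = refl w x := by
    conv_rhs => rw [← h1]
    exact (refl_refl w (refl w' x)).symm
  rw [refl_apply hw, refl_apply hw'] at h2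
  by_contra hwx
  apply hne
  have h3 : w = (inner ℝ w' x / inner ℝ w x) • w' := by
    rw [div_eq_inv_mul, mul_smul, eq_inv_smul_iff₀ hwx]
    linear_combination (norm := module) (1 / 2 : ℝ) • h2
  rcases eq_or_eq_neg_of_smul hw hw' h3 with h4 | h4
  · rw [h4]
  · rw [h4, refl_neg]

theorem exists_isOrderedList {μ : Euc n →ₗ[ℝ] Euc n} (h : IsSteinbergForm W a μ) (σ : Orth n) :
    ∃ (t : ℕ) (τ : Fin t → Euc n), IsOrderedList W a σ t τ := by
  classical
  let K : Finset ℕ := (Finset.range (numPos a)).filter fun k => rho a k ∈ rootsBelow W a σ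
  let k := K.orderEmbOfFin rfl
  have hk : ∀ i, k i < numPos a ∧ rho a (k i) ∈ rootsBelow W a σ := fun i => by
    have hmem : k i ∈ K := K.orderEmbOfFin_mem rfl i
    rwa [Finset.mem_filter, Finset.mem_range] at hmem
  refine ⟨K.card, fun i => rho a (k i), ?_, k, k.strictMono, fun i => ⟨(hk i).1, rfl⟩⟩
  ext v
  constructor
  · rintro ⟨i, rfl⟩
    exact (hk i).2
  · intro hv
    obtain ⟨l, hl, rfl⟩ := h.exists_eq_rho v hv.1
    have : l ∈ Set.range k := by
      rw [K.range_orderEmbOfFin rfl]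
      simpa [K] using ⟨hl, hv⟩
    obtain ⟨i, hi⟩ := this
    exact ⟨i, by simp only [hi]⟩

section RankTwo

variable {μ : Euc n →ₗ[ℝ] Euc n} {σ : Orth n} {t : ℕ} {τ : Fin t → Euc n}

theorem IsOrderedList.injective (h : IsSteinbergForm W a μ) (hτ : IsOrderedList W a σ t τ) :
    Function.Injective τ := by
  obtain ⟨-, k, hk, hτk⟩ := hτ
  intro i j hij
  rw [(hτk i).2, (hτk j).2] at hij
  exact hk.injective (h.injOn (hτk i).1 (hτk j).1 hij)

theorem IsOrderedList.isPositiveRoot (hτ : IsOrderedList W a σ t τ) (i : Fin t) :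
    IsPositiveRoot W a (τ i) := by
  have : τ i ∈ rootsBelow W a σ := hτ.1 ▸ Set.mem_range_self i
  exact this.1

theorem IsOrderedList.exists_factorization (hτ : IsOrderedList W a σ t τ)
    (hW : IsFiniteIrreducibleReflectionGroup W) (ha : IsSimpleSystem W a) (hσ : σ ∈ W)
    (hlen : len W σ = 2) (i : Fin t) :
    ∃ j : Fin t, σ = refl (τ i) * refl (τ j) ∧ refl (τ i) ≠ refl (τ j) := by
  have hi : τ i ∈ rootsBelow W a σ := hτ.1 ▸ Set.mem_range_self i
  obtain ⟨hu, v, hv, rfl⟩ := (mem_rootsBelow_iff hW ha hσ hlen _).1 hi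
  have hv' := mem_rootsBelow_right hW ha hu hv hlen
  rw [← hτ.1] at hv'
  obtain ⟨j, rfl⟩ := hv'
  refine ⟨j, rfl, fun hij => ?_⟩
  rw [hij, refl_mul_self] at hlen
  have := len_le_of_prod (W := W) (L := []) (by simp)
  rw [List.prod_nil, hlen] at this
  simp at this

/-- The second factor is the cyclic predecessor of the first one. -/
theorem IsOrderedList.predecessor (hτ : IsOrderedList W a σ t τ)
    (hW : IsFiniteIrreducibleReflectionGroup W) (ha : IsSimpleSystem W a)
    (h : IsSteinbergForm W a μ) (hσ : Precedes W σ (cox a)) (hlen : len W σ = 2) {i j : Fin t}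
    (hij : σ = refl (τ i) * refl (τ j)) (hne : refl (τ i) ≠ refl (τ j)) (l : Fin t) :
    ¬ ((j < l ∧ l < i) ∨ (l < i ∧ i < j) ∨ (i < j ∧ j < l)) := by
  have hroot := hτ.isPositiveRoot
  obtain ⟨l', hl, hnel⟩ := hτ.exists_factorization hW ha hσ.1 hlen l
  have hspan := mem_span_of_refl_mul_eq (hroot i).1.1 (hroot j).1.1 (hroot l).1.1 (hroot l').1.1
    hnel (hij.symm.trans hl)
  have h0 := h.eq_zero (hroot i).1 (hroot j).1 hne (hij ▸ hσ)
  obtain ⟨-, k, hk, hτk⟩ := hτ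
  rw [(hτk i).2, (hτk j).2] at h0
  rw [(hτk i).2, (hτk j).2, (hτk l).2] at hspan
  have := h.not_between ha (hτk i).1 (hτk j).1 (hτk l).1 h0 hspan
  simpa only [hk.lt_iff_lt] using this

/-- Were the second factor paired with τ_j any root other than τ_{j-1}, then τ_{j-1} would lie
cyclically between it and τ_j. -/
theorem IsOrderedList.eq_succ_mul (hτ : IsOrderedList W a σ t τ)
    (hW : IsFiniteIrreducibleReflectionGroup W) (ha : IsSimpleSystem W a)
    (h : IsSteinbergForm W a μ) (hσ : Precedes W σ (cox a)) (hlen : len W σ = 2) {i j : Fin t}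
    (hij : (j : ℕ) = i + 1) : σ = refl (τ j) * refl (τ i) := by
  obtain ⟨l, hl, hne⟩ := hτ.exists_factorization hW ha hσ.1 hlen j
  have h1 := hτ.predecessor hW ha h hσ hlen hl hne i
  have hlj : l ≠ j := fun e => hne (by rw [e])
  have : l = i := by
    rw [Fin.lt_def, Fin.lt_def, Fin.lt_def] at h1
    have := Fin.val_ne_of_ne hlj
    exact Fin.ext (by omega)
  rw [← this, hl]

/-- The cyclic predecessor of the first root is the last one; it differs from the first since the
two factors are distinct. -/
theorem IsOrderedList.eq_first_mul_last (hτ : IsOrderedList W a σ t τ)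
    (hW : IsFiniteIrreducibleReflectionGroup W) (ha : IsSimpleSystem W a)
    (h : IsSteinbergForm W a μ) (hσ : Precedes W σ (cox a)) (hlen : len W σ = 2) :
    2 ≤ t ∧ ∀ i j : Fin t, (i : ℕ) = 0 → (j : ℕ) = t - 1 → σ = refl (τ i) * refl (τ j) := by
  have ht : 0 < t := by
    obtain ⟨u, v, hu, hv, huv⟩ := hW.exists_refl_mul_of_len hσ.1 hlen
    have : ∃ x, x ∈ rootsBelow W a σ := by
      have hv' : ∃ v, IsPositiveRoot W a v ∧ σ = refl u * refl v := by
        rcases ha.pos_or_neg hv with h | h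
        · exact ⟨v, h, huv⟩
        · exact ⟨-v, h, by rw [refl_neg, huv]⟩
      rcases ha.pos_or_neg hu with h | h
      · exact ⟨u, (mem_rootsBelow_iff hW ha hσ.1 hlen u).2 ⟨h, hv'⟩⟩
      · exact ⟨-u, (mem_rootsBelow_iff hW ha hσ.1 hlen (-u)).2 ⟨h, by rwa [refl_neg]⟩⟩
    obtain ⟨x, hx⟩ := this
    rw [← hτ.1] at hx
    obtain ⟨i, -⟩ := hx
    exact i.pos
  have key : ∀ i : Fin t, (i : ℕ) = 0 →
      2 ≤ t ∧ ∀ j : Fin t, (j : ℕ) = t - 1 → σ = refl (τ i) * refl (τ j) := by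
    intro i hi
    obtain ⟨l, hl, hne⟩ := hτ.exists_factorization hW ha hσ.1 hlen i
    have hli := Fin.val_ne_of_ne fun e : l = i => hne (by rw [e])
    refine ⟨by omega, fun j hj => ?_⟩
    have h1 := hτ.predecessor hW ha h hσ hlen hl hne j
    rw [Fin.lt_def, Fin.lt_def, Fin.lt_def] at h1
    rw [show j = l from Fin.ext (by omega), hl]
  exact ⟨(key ⟨0, ht⟩ rfl).1, fun i j hi => (key i hi).2 j⟩

theorem IsOrderedList.joined_succ (hτ : IsOrderedList W a σ t τ)
    (hW : IsFiniteIrreducibleReflectionGroup W) (ha : IsSimpleSystem W a)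
    (h : IsSteinbergForm W a μ) (hσ : Precedes W σ (cox a)) (hlen : len W σ = 2) {i j : Fin t}
    (hij : (j : ℕ) = i + 1) : Joined W a (τ i) (τ j) ∧ Joined W a (τ j) (τ i) := by
  have h1 := hτ.eq_succ_mul hW ha h hσ hlen hij
  obtain ⟨-, k, hk, hτk⟩ := hτ
  have h2 : Precedes W (refl (τ i) * refl (τ j)) (cox a)⁻¹ := by
    have := hσ.inv hW
    rwa [h1, mul_inv_rev, refl_inv, refl_inv] at this
  rw [(hτk i).2, (hτk j).2] at h2 ⊢
  have hlt : k i < k j := hk (by rw [Fin.lt_def]; omega)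
  exact ⟨⟨k i, k j, hlt, (hτk j).1, h2, Or.inl ⟨rfl, rfl⟩⟩,
    ⟨k i, k j, hlt, (hτk j).1, h2, Or.inr ⟨rfl, rfl⟩⟩⟩

/-- Both τ_i and τ_{j-1} are annihilated by ⟨μτ_j, ·⟩, which is 1 at τ_j. In the plane its kernel is
a line, so the two positive roots coincide. -/
theorem IsOrderedList.succ_of_joined (hτ : IsOrderedList W a σ t τ)
    (hW : IsFiniteIrreducibleReflectionGroup W) (ha : IsSimpleSystem W a)
    (h : IsSteinbergForm W a μ) (hσ : Precedes W σ (cox a)) (hlen : len W σ = 2) {i j : Fin t}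
    (hij : i < j) (hJ : Joined W a (τ i) (τ j)) : (j : ℕ) = i + 1 := by
  have hinj := hτ.injective h
  have hroot := hτ.isPositiveRoot
  have hprec : Precedes W (refl (τ i) * refl (τ j)) (cox a)⁻¹ := by
    obtain ⟨-, k, hk, hτk⟩ := hτ
    obtain ⟨i0, j0, hlt, hj0, hp, ⟨e1, e2⟩ | ⟨e1, e2⟩⟩ := hJ
    · rwa [e1, e2]
    -- `Joined` is symmetric in its arguments; injectivity of the enumeration rules out the reversed
    -- order.
    · have f1 := h.injOn (hτk i).1 hj0 ((hτk i).2.symm.trans e1)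
      have f2 := h.injOn (hτk j).1 (hlt.trans hj0) ((hτk j).2.symm.trans e2)
      have := hk hij
      omega
  have hprec' := hprec.inv hW
  rw [mul_inv_rev, refl_inv, refl_inv, inv_inv] at hprec'
  have hne : refl (τ j) ≠ refl (τ i) := fun e =>
    hij.ne' (hinj (ha.eq_of_refl_eq (hroot j) (hroot i) e))
  have h0 := h.eq_zero (hroot j).1 (hroot i).1 hne hprec'
  rw [Fin.lt_def] at hij
  let l : Fin t := ⟨j - 1, by omega⟩
  have hl : (j : ℕ) = l + 1 := by simp only [l]; omega
  have h1 := hτ.eq_succ_mul hW ha h hσ hlen hl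
  have hnel : refl (τ j) ≠ refl (τ l) := fun e => by
    have := congrArg Fin.val (hinj (ha.eq_of_refl_eq (hroot j) (hroot l) e))
    omega
  have h2 := h.eq_zero (hroot j).1 (hroot l).1 hnel (h1 ▸ hσ)
  obtain ⟨i', hi', hnei⟩ := hτ.exists_factorization hW ha hσ.1 hlen i
  have hspan := mem_span_of_refl_mul_eq (hroot j).1.1 (hroot l).1.1 (hroot i).1.1 (hroot i').1.1
    hnei (h1.symm.trans hi')
  obtain ⟨x, y, hxy⟩ := Submodule.mem_span_pair.1 hspan
  have hx : x = 0 := by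
    rw [← hxy, inner_add_right, inner_smul_right, inner_smul_right,
      h.inner_self_root (hroot j).1, h2] at h0
    linarith
  rw [hx, zero_smul, zero_add] at hxy
  have := congrArg Fin.val (hinj (ha.eq_of_smul (hroot i) (hroot l) hxy.symm))
  omega

/-- The subcomplex below an element of length two is a path. -/
theorem IsOrderedList.xSub_eq (hτ : IsOrderedList W a σ t τ)
    (hW : IsFiniteIrreducibleReflectionGroup W) (ha : IsSimpleSystem W a)
    (h : IsSteinbergForm W a μ) (hσ : Precedes W σ (cox a)) (hlen : len W σ = 2) :
    XSub W a σ = {S : Finset (Euc n) | (∃ i : Fin t, (S : Set (Euc n)) = {τ i}) ∨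
      (∃ (i : ℕ) (hi : i + 1 < t), (S : Set (Euc n)) =
        {τ ⟨i, Nat.lt_of_succ_lt hi⟩, τ ⟨i + 1, hi⟩})} := by
  classical
  have hmem : ∀ i, τ i ∈ rootsBelow W a σ := fun i => hτ.1 ▸ Set.mem_range_self i
  have hvert : ∀ i, ∃ l < numPos a, τ i = rho a l := fun i =>
    h.exists_eq_rho _ (hτ.isPositiveRoot i)
  ext S
  constructor
  · rintro ⟨⟨hS, -, hjoin⟩, hbelow⟩
    have hrange : ∀ v ∈ S, ∃ i, τ i = v := fun v hv => by
      have := hbelow v hv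
      rwa [← hτ.1] at this
    have hne : (Finset.univ.filter fun i => τ i ∈ S).Nonempty := by
      obtain ⟨v, hv⟩ := hS
      obtain ⟨i, rfl⟩ := hrange v hv
      exact ⟨i, by simpa using hv⟩
    -- Every other vertex is joined to the one of least index and so is its successor; a simplex has
    -- at most two vertices.
    obtain ⟨i, hi, hmin⟩ := Finset.exists_min_image _ id hne
    simp only [Finset.mem_filter, Finset.mem_univ, true_and, id] at hi hmin
    have hnext : ∀ j, τ j ∈ S → j ≠ i → (j : ℕ) = i + 1 := fun j hj hji =>
      hτ.succ_of_joined hW ha h hσ hlen (lt_of_le_of_ne (hmin j hj) hji.symm)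
        (hjoin _ hi _ hj fun e => hji (hτ.injective h e).symm)
    by_cases hex : ∃ j, τ j ∈ S ∧ j ≠ i
    · obtain ⟨j, hj, hji⟩ := hex
      have hj1 := hnext j hj hji
      have hit : (i : ℕ) + 1 < t := hj1 ▸ j.2
      have hjeq : j = ⟨i + 1, hit⟩ := Fin.ext hj1
      refine Or.inr ⟨i, hit, ?_⟩
      rw [← hjeq]
      ext v
      simp only [Finset.mem_coe, Set.mem_insert_iff, Set.mem_singleton_iff]
      constructor
      · intro hv
        obtain ⟨l, rfl⟩ := hrange v hv
        by_cases hli : l = i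
        · left; rw [hli]
        · right
          rw [show l = j from Fin.ext ((hnext l hv hli).trans hj1.symm)]
      · rintro (rfl | rfl)
        · exact hi
        · exact hj
    · push Not at hex
      refine Or.inl ⟨i, ?_⟩
      ext v
      simp only [Finset.mem_coe, Set.mem_singleton_iff]
      constructor
      · intro hv
        obtain ⟨l, rfl⟩ := hrange v hv
        rw [hex l hv]
      · rintro rfl
        exact hi
  · rintro (⟨i, hS⟩ | ⟨i, hi, hS⟩)
    · have hv : ∀ v, v ∈ S ↔ v = τ i := fun v => by
        rw [← Finset.mem_coe, hS, Set.mem_singleton_iff]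
      refine ⟨⟨⟨τ i, (hv _).2 rfl⟩, fun v hvS => ?_, fun u hu v hvS huv => ?_⟩, fun v hvS => ?_⟩
      · rw [(hv v).1 hvS]; exact hvert i
      · exact absurd (((hv u).1 hu).trans ((hv v).1 hvS).symm) huv
      · rw [(hv v).1 hvS]; exact hmem i
    · have hv : ∀ v, v ∈ S ↔ v = τ ⟨i, Nat.lt_of_succ_lt hi⟩ ∨ v = τ ⟨i + 1, hi⟩ := fun v => by
        rw [← Finset.mem_coe, hS, Set.mem_insert_iff, Set.mem_singleton_iff]
      have hJ := hτ.joined_succ hW ha h hσ hlen (i := ⟨i, Nat.lt_of_succ_lt hi⟩)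
        (j := ⟨i + 1, hi⟩) rfl
      refine ⟨⟨⟨_, (hv _).2 (Or.inl rfl)⟩, fun v hvS => ?_, fun u hu v hvS huv => ?_⟩,
        fun v hvS => ?_⟩
      · rcases (hv v).1 hvS with rfl | rfl <;> exact hvert _
      · rcases (hv u).1 hu with rfl | rfl <;> rcases (hv v).1 hvS with rfl | rfl
        · exact absurd rfl huv
        · exact hJ.1
        · exact hJ.2
        · exact absurd rfl huv
      · rcases (hv v).1 hvS with rfl | rfl <;> exact hmem _

end RankTwo

end

end CoxeterComplex

theorem theorem5p2 {n : ℕ} [NeZero n] (W : Subgroup (CoxeterComplex.Orth n))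
    (hW : CoxeterComplex.IsFiniteIrreducibleReflectionGroup W)
    (a : Fin n → CoxeterComplex.Euc n) (ha : CoxeterComplex.IsSimpleSystem W a)
    (s : ℕ) (hs : CoxeterComplex.IsBipartite a s)
    (σ : CoxeterComplex.Orth n) (hσ : CoxeterComplex.Precedes W σ (CoxeterComplex.cox a))
    (hlen : CoxeterComplex.len W σ = 2) :
    (∃ (t : ℕ) (τ : Fin t → CoxeterComplex.Euc n), CoxeterComplex.IsOrderedList W a σ t τ) ∧
    ∀ (t : ℕ) (τ : Fin t → CoxeterComplex.Euc n), CoxeterComplex.IsOrderedList W a σ t τ →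
      Function.Injective τ ∧
      CoxeterComplex.XSub W a σ =
        {S : Finset (CoxeterComplex.Euc n) |
          (∃ i : Fin t, (S : Set (CoxeterComplex.Euc n)) = {τ i}) ∨
          (∃ (i : ℕ) (hi : i + 1 < t), (S : Set (CoxeterComplex.Euc n)) =
            {τ ⟨i, Nat.lt_of_succ_lt hi⟩, τ ⟨i + 1, hi⟩})} ∧
      (∃ ht : 2 ≤ t, σ = CoxeterComplex.refl (τ ⟨0, by omega⟩) *
        CoxeterComplex.refl (τ ⟨t - 1, by omega⟩)) ∧
      (∀ (i : ℕ) (hi : i + 1 < t), σ = CoxeterComplex.refl (τ ⟨i + 1, hi⟩) *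
        CoxeterComplex.refl (τ ⟨i, Nat.lt_of_succ_lt hi⟩)) := by
  -- The length of σ is at most that of γ, which is at most n; the rank-one case is vacuous.
  have hn : 2 ≤ n := by
    have h1 := ha.len_cox_le
    have h2 := hσ.2.2
    omega
  obtain ⟨μ, h⟩ := ha.exists_isSteinbergForm hW hn hs
  refine ⟨CoxeterComplex.exists_isOrderedList h σ, fun t τ hτ => ⟨hτ.injective h,
    hτ.xSub_eq hW ha h hσ hlen, ?_,
    fun i hi => hτ.eq_succ_mul hW ha h hσ hlen rfl⟩⟩
  obtain ⟨ht, hfl⟩ := hτ.eq_first_mul_last hW ha h hσ hlen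
  exact ⟨ht, hfl _ _ rfl rfl⟩
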